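/- All graphs are finite and simple. A set $S$ of vertices of a graph $G$ is a zero forcing set if, starting with exactly the vertices of $S$ active and repeatedly applying the rule "if all neighbours of an active vertex $u$ except exactly one neighbour $v$ are active, then $v$ becomes active", all vertices of $G$ become active. It is minimum if it has the least cardinality among all zero forcing sets. A graph $G$ is iso-unique zero forcing if for any two minimum zero forcing sets $S,S'$ of $G$ there is an automorphism $\varphi$ of $G$ with $\varphi(S)=S'$. A path cover of a tree $T$ is a set of (nonempty) vertex-disjoint induced paths of $T$ that cover all vertices of $T$; it is minimum if no path cover has fewer paths. A connector edge of a path cover $\mathcal P$ is an edge $xy$ of $T$ whose ends lie on different paths of $\mathcal P$; the vertices $x,y$ are its connector vertices, and a connector vertex is called interior if it is an interior vertex (not an end-vertex) of the path of $\mathcal P$ containing it; the vertex of a one-vertex path is an end-vertex. A leaf is a vertex of degree $1$ in $T$, and $P_3$ is the path on three vertices. Theorem. Let $T$ be a tree with at least two vertices. Then $T$ is iso-unique zero forcing if and only if every minimum path cover $\mathcal P$ of $T$ satisfies the following three conditions. (i) Both end-vertices of every path of $\mathcal P$ are leaves of $T$. (ii) For every connector edge of $\mathcal P$, either both of its connector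 vertices are interior, or one of them is the interior vertex of a path of $\mathcal P$ isomorphic to $P_3$ and the other is the only vertex of a path of $\mathcal P$. (iii) For every path $x_1,\dots,x_\ell$ of $\mathcal P$, with $p=\frac{\ell+1}{2}$ if $\ell$ is odd and $p=\frac{\ell}{2}$ if $\ell$ is even: (a) if $\ell\ge 3$ is odd, then the connected components of $T-x_p$ that contain $x_{p-1}$ and $x_{p+1}$, respectively, are isomorphic; (b) if $\ell$ is even, then the connected components of $T-x_px_{p+1}$ (the edge $x_px_{p+1}$ deleted) that contain $x_p$ and $x_{p+1}$, respectively, are isomorphic; and in every case there is an automorphism of $T$ that maps $x_1$ to $x_\ell$ and $x_\ell$ to $x_1$. -/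

import Mathlib

namespace ZeroForcing

open SimpleGraph

variable {V : Type*}

/-- One application of the activation rule: in the set `S` of active vertices there is a vertex `u`
whose neighbors are all active except for exactly one neighbor `v`; then `v` becomes active. -/
def Activates [DecidableEq V] (G : SimpleGraph V) (S S' : Finset V) : Prop :=
  ∃ u ∈ S, ∃ v ∉ S, G.Adj u v ∧ (∀ w, G.Adj u w → w ≠ v → w ∈ S) ∧ S' = insert v S

/-- `S` is a zero forcing set: repeated activations starting from `S` make all vertices active. -/
def IsZeroForcingSet [DecidableEq V] [Fintype V] (G : SimpleGraph V) (S : Finset V) : Prop :=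
  Relation.ReflTransGen (Activates G) S Finset.univ

/-- A zero forcing set of minimum cardinality. -/
def IsMinZeroForcingSet [DecidableEq V] [Fintype V] (G : SimpleGraph V) (S : Finset V) : Prop :=
  IsZeroForcingSet G S ∧ ∀ S' : Finset V, IsZeroForcingSet G S' → S.card ≤ S'.card

/-- Any two minimum zero forcing sets are mapped to each other by an automorphism. -/
def IsIsoUniqueZeroForcing [DecidableEq V] [Fintype V] (G : SimpleGraph V) : Prop :=
  ∀ S S' : Finset V, IsMinZeroForcingSet G S → IsMinZeroForcingSet G S' →
    ∃ φ : G ≃g G, S.image φ = S'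

/-- The embedding `x` of the path graph on `ℓ` vertices as an induced subgraph of `G` lists the
vertices of `A` along a path. An induced path is represented by its vertex set `A`; the same path
is listed once in each of its two directions. -/
def Enumerates {G : SimpleGraph V} {ℓ : ℕ} (x : pathGraph ℓ ↪g G) (A : Finset V) : Prop :=
  Set.range x = (A : Set V)

/-- `A` is the vertex set of a (nonempty) induced path of `G`. -/
def IsInducedPath (G : SimpleGraph V) (A : Finset V) : Prop :=
  A.Nonempty ∧ ∃ (ℓ : ℕ) (x : pathGraph ℓ ↪g G), Enumerates x A

/-- `v` is an end-vertex of the induced path `A`, that is, the first vertex of the path in one of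
its two directions. For a one-vertex path, the vertex is an end-vertex. -/
def IsEndVertex (G : SimpleGraph V) (A : Finset V) (v : V) : Prop :=
  ∃ (n : ℕ) (x : pathGraph (n + 1) ↪g G), Enumerates x A ∧ x 0 = v

/-- `v` is an interior vertex of the induced path `A`. -/
def IsInteriorVertex (G : SimpleGraph V) (A : Finset V) (v : V) : Prop :=
  v ∈ A ∧ ¬ IsEndVertex G A v

/-- A set of vertex-disjoint induced paths covering all vertices. -/
structure IsPathCover (G : SimpleGraph V) (P : Finset (Finset V)) : Prop where
  isInducedPath : ∀ A ∈ P, IsInducedPath G A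
  disjoint : ∀ A ∈ P, ∀ B ∈ P, A ≠ B → Disjoint A B
  cover : ∀ v : V, ∃ A ∈ P, v ∈ A

/-- A path cover with the minimum number of paths. -/
def IsMinPathCover (G : SimpleGraph V) (P : Finset (Finset V)) : Prop :=
  IsPathCover G P ∧ ∀ P' : Finset (Finset V), IsPathCover G P' → P.card ≤ P'.card

/-- The connected component containing `u` of the graph `G - v`. -/
def deleteVertexComponent (G : SimpleGraph V) (v u : V) (h : u ≠ v) :=
  ((G.induce {v}ᶜ).connectedComponentMk ⟨u, h⟩).toSimpleGraph

/-- The connected component containing `u` of the graph `G - ab`. -/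
def deleteEdgeComponent (G : SimpleGraph V) (a b u : V) :=
  ((G.deleteEdges {s(a, b)}).connectedComponentMk u).toSimpleGraph

/-- Every end-vertex of every path of `P` is a leaf. -/
def EndVerticesAreLeaves [Fintype V] (G : SimpleGraph V) [DecidableRel G.Adj]
    (P : Finset (Finset V)) : Prop :=
  ∀ A ∈ P, ∀ v, IsEndVertex G A v → G.degree v = 1

/-- `x` is an interior vertex of a path `A` isomorphic to `P₃`, and `y` is the only vertex of the
path `B`. -/
def InteriorP3ToSingle (G : SimpleGraph V) (A B : Finset V) (x y : V) : Prop :=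
  IsInteriorVertex G A x ∧ Nonempty (G.induce (A : Set V) ≃g pathGraph 3) ∧ B = {y}

/-- The condition on the connector edges `xy` of `P`: both ends are interior, or one end is the
interior vertex of a `P₃` of `P` and the other is the only vertex of a path of `P`. -/
def ConnectorCondition (G : SimpleGraph V) (P : Finset (Finset V)) : Prop :=
  ∀ A ∈ P, ∀ B ∈ P, A ≠ B → ∀ x ∈ A, ∀ y ∈ B, G.Adj x y →
    (IsInteriorVertex G A x ∧ IsInteriorVertex G B y) ∨
      InteriorP3ToSingle G A B x y ∨ InteriorP3ToSingle G B A y x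

/-- The condition on the halves of a path, for one listing `x 0, …, x (ℓ - 1)` of a path. For odd `ℓ` the middle vertex is
`x j` with `2 * j + 1 = ℓ`, and the requirement is vacuous for `ℓ = 1`; for even `ℓ` the middle edge
joins `x i` and `x j` with `i + 1 = j` and `2 * j = ℓ`. -/
structure HalvesCondition (G : SimpleGraph V) {ℓ : ℕ} (x : pathGraph ℓ ↪g G) : Prop where
  odd : ∀ (i j k : Fin ℓ) (hij : i.val + 1 = j.val) (hjk : j.val + 1 = k.val),
    2 * j.val + 1 = ℓ →
    Nonempty (
      deleteVertexComponent G (x j) (x i)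
          (x.injective.ne (Fin.ne_of_val_ne (by omega))) ≃g
        deleteVertexComponent G (x j) (x k)
          (x.injective.ne (Fin.ne_of_val_ne (by omega))))
  even : ∀ i j : Fin ℓ, i.val + 1 = j.val → 2 * j.val = ℓ →
    Nonempty (deleteEdgeComponent G (x i) (x j) (x i) ≃g
      deleteEdgeComponent G (x i) (x j) (x j))
  swap : ∀ a b : Fin ℓ, a.val = 0 → b.val + 1 = ℓ →
    ∃ φ : G ≃g G, φ (x a) = x b ∧ φ (x b) = x a

end ZeroForcing

namespace ZeroForcing

open SimpleGraph

variable {V : Type*} {T H : SimpleGraph V} {P : Finset (Finset V)}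

/-! A path cover of a tree amounts to a subgraph `H` with all degrees at most two, since the
components of such a subgraph are induced paths. A set with one vertex in each component has |V| -
|E(H)| elements, so minimum path covers correspond to the `H` with the most edges (`IsMaxLinear`).
Forcing chains turn a zero forcing set into such an `H` together with one end chosen on each path,
and conversely every choice of ends forces. Hence the minimum zero forcing sets are exactly the
choices of one end on each path of a minimum path cover (`isMinZeroForcingSet_iff`).

Necessity. Trade one end of a path for the other: counting elements in the orbit of the first end
shows that both ends lie in one orbit (`exists_iso_of_isIsoUnique`). By rerouting paths across
connector edges, the failure to have a leaf as an end would spread through a subgraph of minimum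
degree two, which a finite tree does not have; so ends are leaves (`isEnd_of_isIsoUnique`).
Condition (ii) then follows by exchanging single edges. For (iii), every automorphism fixes a center
`c` of the tree or moves it along an inverted edge, so an automorphism taking one end of a path to
the other can be trimmed to an involution that reverses the path
(`IsNonbacktracking.exists_reflection`).

Sufficiency. Conditions (i) and (ii) make the maximum `H` rigid: two of them differ only around
vertices with at least three leaves (`HasLeafEnds.adj_of_adj`). Relative to one fixed `H`, two
minimum zero forcing sets therefore differ only in the ends chosen on common paths and in the leaf
omitted at each star center. The automorphisms in (iii) give flips of single paths that fix all
other paths at least as close to `c` (`exists_flip`), so wrong ends can be corrected in order of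
increasing distance from `c` (`HasLeafEnds.isIsoUniqueZeroForcing`). The remaining differences are
removed by swapping leaves (`HasLeafEnds.exists_iso_of_agree`). -/

/-! ### Distances in a tree -/

lemma dist_lt_or_gt (hT : T.IsTree) (r : V) {u v : V} (h : T.Adj u v) :
    T.dist r u = T.dist r v + 1 ∨ T.dist r v = T.dist r u + 1 :=
  hT.dist_eq_dist_add_one_of_adj r h

/-- A geodesic from `r` to a closer neighbor of `u`, extended by the edge to `u`, is the unique path
from `r` to `u`, so that neighbor is its penultimate vertex. -/
lemma parent_unique (hT : T.IsTree) {r u v w : V} (huv : T.Adj u v) (huw : T.Adj u w)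
    (hv : T.dist r v < T.dist r u) (hw : T.dist r w < T.dist r u) : v = w := by
  have key : ∀ z, T.Adj u z → T.dist r z < T.dist r u →
      ∃ p : T.Walk r u, p.IsPath ∧ p.penultimate = z := by
    intro z hz hlt
    obtain ⟨p, hp⟩ := hT.connected.exists_walk_length_eq_dist r z
    refine ⟨p.concat hz.symm, ?_, by simp⟩
    apply Walk.isPath_of_length_eq_dist
    have := dist_lt_or_gt hT r hz
    simp only [Walk.length_concat]
    omega
  obtain ⟨p, hp, rfl⟩ := key v huv hv
  obtain ⟨q, hq, rfl⟩ := key w huw hw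
  rw [(hT.existsUnique_path r u).unique hp hq]

lemma exists_parent (hT : T.IsTree) {r u : V} (h : u ≠ r) :
    ∃ v, T.Adj u v ∧ T.dist r u = T.dist r v + 1 := by
  obtain ⟨p, hp⟩ := hT.connected.exists_walk_length_eq_dist u r
  cases p with
  | nil => exact absurd rfl h
  | @cons _ v _ huv q =>
    refine ⟨v, huv, ?_⟩
    have h1 := dist_lt_or_gt hT r huv
    have h2 := dist_le q
    simp only [Walk.length_cons] at hp
    rw [dist_comm] at hp h2
    omega

lemma dist_increases (hT : T.IsTree) {r u v w : V} (huv : T.Adj u v) (hvw : T.Adj v w)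
    (huw : u ≠ w) (h : T.dist r u < T.dist r v) : T.dist r w = T.dist r v + 1 := by
  rcases dist_lt_or_gt hT r hvw with h1 | h1
  · exact absurd (parent_unique hT huv.symm hvw h (by omega)) huw
  · exact h1

/-- In a finite tree there is no nonempty set of oriented edges each of which can be continued
inside the set without turning back. -/
lemma no_nonbacktracking [Finite V] (hT : T.IsTree) (D : V → V → Prop)
    (hadj : ∀ a b, D a b → T.Adj a b) (hstep : ∀ a b, D a b → ∃ c, c ≠ a ∧ D b c) (a b : V) :
    ¬ D a b := by
  intro h
  have key : ∀ n : ℕ, ∃ u v, D u v ∧ T.dist a u = n ∧ T.dist a v = n + 1 := by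
    intro n
    induction n with
    | zero => exact ⟨a, b, h, by simp, by simpa using hadj a b h⟩
    | succ n ih =>
      obtain ⟨u, v, huv, hu, hv⟩ := ih
      obtain ⟨w, hwu, hvw⟩ := hstep u v huv
      refine ⟨v, w, hvw, hv, ?_⟩
      rw [dist_increases hT (hadj _ _ huv) (hadj _ _ hvw) hwu.symm (by omega), hv]
  obtain ⟨N, hN⟩ := (Set.finite_range (T.dist a)).bddAbove
  obtain ⟨u, v, -, hu, -⟩ := key (N + 1)
  have := hN ⟨u, rfl⟩
  omega

/-- Inside a nonempty such set one could walk forever without turning back. This is the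
contradiction behind both `isEnd_of_isIsoUnique` and `HasLeafEnds.adj_of_adj`. -/
lemma set_eq_empty_of_two_neighbors [Finite V] (hT : T.IsTree) (X : Set V)
    (h : ∀ v ∈ X, ∃ w ∈ X, ∃ z ∈ X, w ≠ z ∧ T.Adj v w ∧ T.Adj v z) (v : V) : v ∉ X := by
  intro hv
  obtain ⟨w, hw, -, -, -, hvw, -⟩ := h v hv
  refine no_nonbacktracking hT (fun a b => T.Adj a b ∧ b ∈ X) (fun a b h => h.1) ?_ v w ⟨hvw, hw⟩
  rintro a b ⟨-, hb⟩
  obtain ⟨c, hc, d, hd, hcd, hbc, hbd⟩ := h b hb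
  by_cases hca : c = a
  · exact ⟨d, fun hda => hcd (hca.trans hda.symm), hbd, hd⟩
  · exact ⟨c, hca, hbc, hc⟩

/-- Distances along a non-backtracking sequence of vertices of a tree. -/
lemma dist_of_nonbacktracking (hT : T.IsTree) (y : ℕ → V) (n : ℕ)
    (hadj : ∀ i, i < n → T.Adj (y i) (y (i + 1)))
    (hne : ∀ i, i + 1 < n → y i ≠ y (i + 2)) {i t : ℕ} (h : i + t ≤ n) :
    T.dist (y i) (y (i + t)) = t := by
  have key : ∀ t, i + t + 1 ≤ n → T.dist (y i) (y (i + t)) = t ∧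
      T.dist (y i) (y (i + t + 1)) = t + 1 := by
    intro t
    induction t with
    | zero => intro h; exact ⟨by simp, by simpa using hadj i (by omega)⟩
    | succ t ih =>
      intro h
      obtain ⟨h1, h2⟩ := ih (by omega)
      refine ⟨h2, ?_⟩
      rw [show i + (t + 1) + 1 = i + t + 2 by omega, dist_increases hT (hadj (i + t) (by omega))
        (hadj (i + t + 1) (by omega)) (hne (i + t) (by omega)) (by omega), h2]
  cases t with
  | zero => simp
  | succ t => exact (key t (by omega)).2

/-- A non-backtracking sequence of vertices of a tree is an induced path. -/
lemma exists_embedding_of_nonbacktracking (hT : T.IsTree) (y : ℕ → V) (n : ℕ)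
    (hadj : ∀ i, i < n → T.Adj (y i) (y (i + 1)))
    (hne : ∀ i, i + 1 < n → y i ≠ y (i + 2)) :
    ∃ x : pathGraph (n + 1) ↪g T, ∀ i : Fin (n + 1), x i = y i := by
  have hd : ∀ i j : Fin (n + 1), i.val ≤ j.val → T.dist (y i) (y j) = j.val - i.val := by
    intro i j hij
    have := dist_of_nonbacktracking hT y n hadj hne (i := i) (t := j.val - i.val) (by omega)
    rwa [Nat.add_sub_cancel' hij] at this
  have hinj : Function.Injective (fun i : Fin (n + 1) => y i) := by
    intro i j hij
    simp only at hij
    rcases le_total i.val j.val with h | h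
    · have := hd i j h
      rw [hij, dist_self] at this
      exact Fin.ext (by omega)
    · have := hd j i h
      rw [hij, dist_self] at this
      exact Fin.ext (by omega)
  refine ⟨⟨⟨fun i => y i, hinj⟩, ?_⟩, fun i => rfl⟩
  intro i j
  change T.Adj (y i) (y j) ↔ (pathGraph (n + 1)).Adj i j
  rw [pathGraph_adj, ← dist_eq_one_iff_adj]
  rcases le_total i.val j.val with h | h
  · rw [hd i j h]; omega
  · rw [SimpleGraph.dist_comm, hd j i h]; omega

/-- A walk from the far side of the edge `ab` has to use this edge. -/
lemma dist_across_edge (hT : T.IsTree) {a b v w : V} (hab : T.Adj a b)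
    (hv : T.dist v a < T.dist v b) (hw : T.dist w b < T.dist w a) :
    T.dist v w = T.dist v a + 1 + T.dist b w := by
  induction hn : T.dist v w using Nat.strong_induction_on generalizing w with
  | _ n ih =>
    have hle : n ≤ T.dist v a + 1 + T.dist b w := by
      have h1 := hT.connected.dist_triangle (u := v) (v := a) (w := w)
      have h2 := hT.connected.dist_triangle (u := a) (v := b) (w := w)
      have h3 : T.dist a b = 1 := by simpa using hab
      omega
    have hvw : w ≠ v := by rintro rfl; omega
    obtain ⟨z, hwz, hz⟩ := exists_parent hT hvw
    by_cases hzb : T.dist z b < T.dist z a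
    · have := ih (T.dist v z) (by omega) hzb rfl
      have h1 := hT.connected.dist_triangle (u := b) (v := z) (w := w)
      have h2 : T.dist z w = 1 := by simpa using hwz.symm
      omega
    · have h1 := dist_lt_or_gt hT z hab
      have h2 := dist_lt_or_gt hT w hab
      -- The edge `wz` crosses to the side of `a`. If `w ≠ b`, then `z` and the neighbor `u` of `w`
      -- towards `b` are both the parent of `w` seen from `a`, hence equal, which the distances to
      -- `a` and `b` exclude.
      have hwb : w = b := by
        by_contra hwb
        obtain ⟨u, hwu, hu⟩ := exists_parent hT hwb
        have h3 := dist_lt_or_gt hT a hwz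
        have h4 := dist_lt_or_gt hT b hwz
        have h5 := hT.connected.dist_triangle (u := a) (v := b) (w := u)
        have h6 : T.dist a b = 1 := by simpa using hab
        rw [dist_comm (u := z) (v := a), dist_comm (u := z) (v := b)] at h1
        rw [dist_comm (u := w) (v := a), dist_comm (u := w) (v := b)] at h2
        rw [dist_comm (u := w) (v := a), dist_comm (u := w) (v := b)] at hw
        rw [dist_comm (u := z) (v := a), dist_comm (u := z) (v := b)] at hzb
        have : u = z := parent_unique hT (r := a) hwu hwz (by omega) (by omega)
        subst this
        omega
      subst hwb
      have : T.dist v a < T.dist v w := hv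
      have := parent_unique hT (r := v) hab.symm hwz this (by omega)
      subst this
      simp
      omega

/-! ### Automorphisms that exchange branches, and the center -/

lemma dist_iso (φ : T ≃g T) (u v : V) : T.dist (φ u) (φ v) = T.dist u v := by
  have key : ∀ (ψ : T ≃g T) (a b : V), T.Reachable a b → T.dist (ψ a) (ψ b) ≤ T.dist a b := by
    intro ψ a b h
    obtain ⟨p, hp⟩ := h.exists_walk_length_eq_dist
    rw [← hp, ← Walk.length_map ψ.toHom p]
    exact dist_le _
  by_cases h : T.Reachable u v
  · refine le_antisymm (key φ u v h) ?_
    simpa using key φ.symm (φ u) (φ v) (φ.reachable_iff.2 h)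
  · rw [dist_eq_zero_of_not_reachable h,
      dist_eq_zero_of_not_reachable (fun h' => h (φ.reachable_iff.1 h'))]

/-- An edge leaving the branch at `m` through its neighbor `x` is the edge `xm`. -/
lemma edge_leaving_branch (hT : T.IsTree) {m x u w : V} (hmx : T.Adj m x) (huw : T.Adj u w)
    (hu : T.dist u x < T.dist u m) (hw : ¬ T.dist w x < T.dist w m) : u = x ∧ w = m := by
  have h1 := dist_lt_or_gt hT w hmx
  have h2 := dist_across_edge hT hmx (v := w) (w := u) (by omega) hu
  have h3 : T.dist w u = 1 := by simpa using huw.symm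
  have h4 : T.dist w m = 0 := by omega
  have h5 : T.dist x u = 0 := by omega
  exact ⟨((hT.connected.dist_eq_zero_iff).1 h5).symm, (hT.connected.dist_eq_zero_iff).1 h4⟩

lemma branches_disjoint (hT : T.IsTree) {m x y v : V} (hx : T.Adj m x) (hy : T.Adj m y)
    (hxy : x ≠ y) (hv : T.dist v x < T.dist v m) : ¬ T.dist v y < T.dist v m :=
  fun h => hxy (parent_unique hT hx hy hv h)

open Classical in
/-- Exchange two disjoint vertex sets by an automorphism and its inverse. -/
lemma exists_local_swap (φ : T ≃g T) (X Y : Set V) (hXY : ∀ v ∈ X, v ∉ Y)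
    (hφ : ∀ v, v ∈ X ↔ φ v ∈ Y)
    (hX : ∀ u w, u ∈ X → w ∉ X → w ∉ Y → T.Adj u w → T.Adj (φ u) w)
    (hY : ∀ u w, u ∈ Y → w ∉ X → w ∉ Y → T.Adj u w → T.Adj (φ.symm u) w)
    (hc : ∀ u w, u ∈ X → w ∈ Y → T.Adj u w → T.Adj (φ u) (φ.symm w)) :
    ∃ ψ : T ≃g T, (∀ v, ψ (ψ v) = v) ∧ (∀ v ∈ X, ψ v = φ v) ∧ (∀ v ∈ Y, ψ v = φ.symm v) ∧
      ∀ v, v ∉ X → v ∉ Y → ψ v = v := by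
  have hφ' : ∀ v, v ∈ Y → φ.symm v ∈ X := fun v hv => (hφ _).2 (by simpa using hv)
  let f : V → V := fun v => if v ∈ X then φ v else if v ∈ Y then φ.symm v else v
  have fX : ∀ v ∈ X, f v = φ v := fun v hv => if_pos hv
  have fY : ∀ v ∈ Y, f v = φ.symm v := fun v hv => by
    have : v ∉ X := fun h => hXY v h hv
    simp [f, this, hv]
  have fN : ∀ v, v ∉ X → v ∉ Y → f v = v := fun v h1 h2 => by simp [f, h1, h2]
  have hff : ∀ v, f (f v) = v := by
    intro v
    by_cases h1 : v ∈ X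
    · rw [fX v h1, fY _ ((hφ v).1 h1)]; simp
    · by_cases h2 : v ∈ Y
      · rw [fY v h2, fX _ (hφ' v h2)]; simp
      · rw [fN v h1 h2, fN v h1 h2]
  have hadj : ∀ u w, T.Adj u w → T.Adj (f u) (f w) := by
    intro u w h
    by_cases u1 : u ∈ X
    · by_cases w1 : w ∈ X
      · rw [fX u u1, fX w w1]; exact φ.map_adj_iff.2 h
      · by_cases w2 : w ∈ Y
        · rw [fX u u1, fY w w2]; exact hc u w u1 w2 h
        · rw [fX u u1, fN w w1 w2]; exact hX u w u1 w1 w2 h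
    · by_cases u2 : u ∈ Y
      · by_cases w1 : w ∈ X
        · rw [fY u u2, fX w w1]; exact (hc w u w1 u2 h.symm).symm
        · by_cases w2 : w ∈ Y
          · rw [fY u u2, fY w w2]; exact φ.symm.map_adj_iff.2 h
          · rw [fY u u2, fN w w1 w2]; exact hY u w u2 w1 w2 h
      · by_cases w1 : w ∈ X
        · rw [fN u u1 u2, fX w w1]; exact (hX w u w1 u1 u2 h.symm).symm
        · by_cases w2 : w ∈ Y
          · rw [fN u u1 u2, fY w w2]; exact (hY w u w2 u1 u2 h.symm).symm
          · rw [fN u u1 u2, fN w w1 w2]; exact h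
  refine ⟨⟨⟨f, f, hff, hff⟩, ?_⟩, hff, fX, fY, fN⟩
  intro u w
  refine ⟨fun h => ?_, hadj u w⟩
  have := hadj _ _ h
  simpa [hff] using this

/-- Exchange the branches of a fixed vertex through two of its neighbors. -/
lemma exists_branch_swap (hT : T.IsTree) (φ : T ≃g T) {m x y : V} (hm : φ m = m) (hxy : φ x = y)
    (hne : x ≠ y) (hx : T.Adj m x) :
    ∃ ψ : T ≃g T, (∀ v, ψ (ψ v) = v) ∧ (∀ v, T.dist v x < T.dist v m → ψ v = φ v) ∧
      ∀ v, ¬ T.dist v x < T.dist v m → ¬ T.dist v y < T.dist v m → ψ v = v := by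
  have hy : T.Adj m y := by rw [← hm, ← hxy]; exact φ.map_adj_iff.2 hx
  have hφ : ∀ v, T.dist v x < T.dist v m ↔ T.dist (φ v) y < T.dist (φ v) m := by
    intro v
    rw [← dist_iso φ v x, ← dist_iso φ v m, hm, hxy]
  obtain ⟨ψ, h1, h2, h3, h4⟩ := exists_local_swap φ {v | T.dist v x < T.dist v m}
    {v | T.dist v y < T.dist v m} (fun v hv => branches_disjoint hT hx hy hne hv) hφ
    (by
      intro u w hu hw _ huw
      obtain ⟨rfl, rfl⟩ := edge_leaving_branch hT hx huw hu hw
      rw [hxy]; exact hy.symm)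
    (by
      intro u w hu _ hw huw
      obtain ⟨rfl, rfl⟩ := edge_leaving_branch hT hy huw hu hw
      rw [← hxy]; simpa using hx.symm)
    (by
      intro u w hu hw huw
      obtain ⟨rfl, rfl⟩ := edge_leaving_branch hT hx huw hu
        (fun h => branches_disjoint hT hx hy hne h hw)
      simp at hw)
  exact ⟨ψ, h1, h2, h4⟩

/-- Make an automorphism that inverts an edge into an involution. -/
lemma exists_edge_swap (hT : T.IsTree) (φ : T ≃g T) {a b : V} (hab : φ a = b) (hba : φ b = a)
    (h : T.Adj a b) :
    ∃ ψ : T ≃g T, (∀ v, ψ (ψ v) = v) ∧ (∀ v, T.dist v a < T.dist v b → ψ v = φ v) := by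
  have hφ : ∀ v, T.dist v a < T.dist v b ↔ T.dist (φ v) b < T.dist (φ v) a := by
    intro v
    rw [← dist_iso φ v a, ← dist_iso φ v b, hab, hba]
  have hn : ∀ v, ¬ T.dist v a < T.dist v b → ¬ T.dist v b < T.dist v a → False := by
    intro v h1 h2
    have := dist_lt_or_gt hT v h
    omega
  obtain ⟨ψ, h1, h2, h3, h4⟩ := exists_local_swap φ {v | T.dist v a < T.dist v b}
    {v | T.dist v b < T.dist v a} (fun v hv hv1 => lt_asymm (Set.mem_ofPred.1 hv) (Set.mem_ofPred.1 hv1)) hφ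
    (by intro u w _ h1 h2; exact (hn w h1 h2).elim)
    (by intro u w _ h1 h2; exact (hn w h1 h2).elim)
    (by
      intro u w hu hw huw
      obtain ⟨rfl, rfl⟩ := edge_leaving_branch hT h.symm huw hu (lt_asymm hw)
      rw [hab, show φ.symm w = u by rw [← hab]; simp]
      exact h.symm)
  exact ⟨ψ, h1, h2⟩

/-- A finite tree has a vertex which every automorphism fixes or moves along an inverted edge. -/
lemma exists_center [Fintype V] (hT : T.IsTree) :
    ∃ c : V, ∀ φ : T ≃g T, φ c = c ∨ (T.Adj c (φ c) ∧ φ (φ c) = c) := by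
  have := hT.connected.nonempty
  let f : V → ℕ := fun c => ∑ v, T.dist v c
  have hf : ∀ (φ : T ≃g T) c, f (φ c) = f c := by
    intro φ c
    simp only [f]
    rw [← Equiv.sum_comp φ.toEquiv]
    exact Finset.sum_congr rfl fun v _ => dist_iso φ v c
  obtain ⟨c, hc⟩ := Finite.exists_min f
  -- Distance is convex along paths: moving two nonadjacent minimizers `a`, `b` one step towards
  -- each other increases the sum of their distances at no vertex and decreases it at `a'`. So
  -- distinct minimizers of the total distance are adjacent.
  have key : ∀ a b, (∀ v, f a ≤ f v) → (∀ v, f b ≤ f v) → a ≠ b → T.Adj a b := by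
    intro a b ha hb hab
    obtain ⟨a', haa, ha'⟩ := exists_parent hT hab
    obtain ⟨b', hbb, hb'⟩ := exists_parent hT hab.symm
    by_contra hnadj
    have hpt : ∀ v, T.dist v a' + T.dist v b' ≤ T.dist v a + T.dist v b := by
      intro v
      have h1 := dist_lt_or_gt hT v haa
      have h2 := dist_lt_or_gt hT v hbb
      by_contra hlt
      have := dist_across_edge hT haa (v := v) (w := b) (by omega) (by omega)
      have h3 := hT.connected.dist_triangle (u := v) (v := a) (w := b')
      have h4 : T.dist b a = T.dist a b := SimpleGraph.dist_comm
      have h5 : T.dist b a' = T.dist a' b := SimpleGraph.dist_comm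
      omega
    have hst : T.dist a' a' + T.dist a' b' < T.dist a' a + T.dist a' b := by
      have h1 : T.dist a' a = 1 := by simpa using haa.symm
      have h2 := hT.connected.dist_triangle (u := a') (v := b) (w := b')
      have h3 : T.dist b b' = 1 := by simpa using hbb
      have h4 : a' ≠ b := by rintro rfl; exact hnadj haa
      have h5 := dist_lt_or_gt hT a' hbb
      have h6 := dist_lt_or_gt hT b' haa
      simp only [SimpleGraph.dist_self]
      by_contra hlt
      have h7 : T.dist a' b' = T.dist a' b + 1 := by omega
      have h8 := dist_across_edge hT hbb (v := a') (w := a) (by omega) (by omega)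
      have h9 : T.dist b a = T.dist a b := SimpleGraph.dist_comm
      have h10 : T.dist b a' = T.dist a' b := SimpleGraph.dist_comm
      have h11 := hT.connected.pos_dist_of_ne h4
      omega
    have h1 : f a' + f b' < f a + f b := by
      simp only [f, ← Finset.sum_add_distrib]
      exact Finset.sum_lt_sum (fun v _ => hpt v) ⟨a', Finset.mem_univ _, hst⟩
    have h2 := ha a'
    have h3 := hb b'
    omega
  refine ⟨c, fun φ => ?_⟩
  by_cases h : φ c = c
  · exact Or.inl h
  · right
    have h1 : ∀ v, f (φ c) ≤ f v := fun v => (hf φ c).trans_le (hc v)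
    have h2 : ∀ v, f (φ (φ c)) ≤ f v := fun v => (hf φ _).trans_le (h1 v)
    have h3 := key _ _ hc h1 (Ne.symm h)
    refine ⟨h3, ?_⟩
    by_contra h4
    have h5 := key _ _ hc h2 (Ne.symm h4)
    -- Otherwise `c`, `φ c`, `φ (φ c)` would form a triangle.
    have h6 : T.Adj (φ c) (φ (φ c)) := φ.map_adj_iff.2 h3
    have h7 := dist_lt_or_gt hT c h6
    have h8 : T.dist c (φ c) = 1 := by simpa using h3
    have h9 : T.dist c (φ (φ c)) = 1 := by simpa using h5
    omega

/-! ### Reflections of a path -/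

/-- `y 0, …, y n` is a non-backtracking walk of `T`. -/
structure IsNonbacktracking (T : SimpleGraph V) (y : ℕ → V) (n : ℕ) : Prop where
  adj : ∀ i, i < n → T.Adj (y i) (y (i + 1))
  ne : ∀ i, i + 1 < n → y i ≠ y (i + 2)

namespace IsNonbacktracking

variable {y : ℕ → V} {n : ℕ}

lemma reverse (h : IsNonbacktracking T y n) : IsNonbacktracking T (fun i => y (n - i)) n where
  adj i hi := by
    have := h.adj (n - (i + 1)) (by omega)
    rw [show n - (i + 1) + 1 = n - i by omega] at this
    exact this.symm
  ne i hi := by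
    have := h.ne (n - (i + 2)) (by omega)
    rw [show n - (i + 2) + 2 = n - i by omega] at this
    exact this.symm

lemma dist_eq (h : IsNonbacktracking T y n) (hT : T.IsTree) {i j : ℕ} (hij : i ≤ j) (hj : j ≤ n) :
    T.dist (y i) (y j) = j - i := by
  have := dist_of_nonbacktracking hT y n h.adj h.ne (i := i) (t := j - i) (by omega)
  rwa [Nat.add_sub_cancel' hij] at this

lemma dist_eq' (h : IsNonbacktracking T y n) (hT : T.IsTree) {i j : ℕ} (hij : i ≤ j) (hj : j ≤ n) :
    T.dist (y j) (y i) = j - i := by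
  rw [SimpleGraph.dist_comm, h.dist_eq hT hij hj]

/-- By minimality the first step after `y k` leads away from `c`, and a walk that does not turn back
can never approach `c` again afterwards. -/
lemma dist_right_of_min (h : IsNonbacktracking T y n) (hT : T.IsTree) (c : V) {k : ℕ}
    (hk : ∀ i, i ≤ n → T.dist c (y k) ≤ T.dist c (y i)) (t : ℕ) (ht : k + t ≤ n) :
    T.dist c (y (k + t)) = T.dist c (y k) + t := by
  have key : ∀ t, k + t + 1 ≤ n → T.dist c (y (k + t)) = T.dist c (y k) + t ∧
      T.dist c (y (k + t + 1)) = T.dist c (y k) + t + 1 := by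
    intro t
    induction t with
    | zero =>
      intro ht
      have h1 := dist_lt_or_gt hT c (h.adj k (by omega))
      have h2 := hk (k + 1) (by omega)
      exact ⟨rfl, by simp only [Nat.add_zero]; omega⟩
    | succ t ih =>
      intro ht
      obtain ⟨h1, h2⟩ := ih (by omega)
      refine ⟨by rw [← add_assoc, h2]; omega, ?_⟩
      rw [show k + (t + 1) + 1 = k + t + 2 by omega, dist_increases hT (h.adj (k + t) (by omega))
        (h.adj (k + t + 1) (by omega)) (h.ne (k + t) (by omega)) (by omega), h2]
      omega
  cases t with
  | zero => rfl
  | succ t => exact (key t (by omega)).2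

/-- Seen from a vertex `c`, a path first approaches `c` and then moves away. -/
lemma exists_valley (h : IsNonbacktracking T y n) (hT : T.IsTree) (c : V) :
    ∃ k ≤ n, (∀ i, k ≤ i → i ≤ n → T.dist c (y i) = T.dist c (y k) + (i - k)) ∧
      ∀ i, i ≤ k → T.dist c (y i) = T.dist c (y k) + (k - i) := by
  obtain ⟨k, hk, hmin⟩ := Finset.exists_min_image (Finset.range (n + 1))
    (fun i => T.dist c (y i)) ⟨0, by simp⟩
  simp only [Finset.mem_range] at hk hmin
  refine ⟨k, by omega, ?_, ?_⟩
  · intro i h1 h2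
    have := h.dist_right_of_min hT c (k := k) (fun i hi => hmin i (by omega)) (i - k) (by omega)
    rwa [Nat.add_sub_cancel' h1] at this
  · intro i h1
    have := h.reverse.dist_right_of_min hT c (k := n - k)
      (fun i hi => by
        rw [show n - (n - k) = k by omega]
        exact hmin (n - i) (by omega)) (k - i) (by omega)
    rw [show n - (n - k + (k - i)) = i by omega, show n - (n - k) = k by omega] at this
    exact this

/-- Both ends are equally far from `c`, so the vertex `y k` of the path nearest to `c` is its
middle. As parents towards `c` are unique, `φ` carries the first half onto the second and fixes `y
k`. Cutting `φ` down to an exchange of the two branches at `y k` makes it an involution with small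
support. -/
lemma exists_reflection_of_fixed (h : IsNonbacktracking T y n) (hT : T.IsTree) (φ : T ≃g T) {c : V}
    (hc : φ c = c) (hφ : φ (y 0) = y n) :
    ∃ ψ : T ≃g T, (∀ v, ψ (ψ v) = v) ∧ (∀ i ≤ n, ψ (y i) = y (n - i)) ∧
      ∃ k ≤ n, ∀ v, ψ v ≠ v → ∃ j ≤ n, T.Adj (y k) (y j) ∧
        T.dist v (y j) < T.dist v (y k) ∧ T.dist c (y k) < T.dist c (y j) := by
  obtain ⟨k, hk, hr, hl⟩ := h.exists_valley hT c
  have hφc : ∀ v, T.dist c (φ v) = T.dist c v := by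
    intro v
    rw [← dist_iso φ c v, hc]
  have h0 := hl 0 (by omega)
  have hn := hr n hk le_rfl
  have h1 := hφc (y 0)
  rw [hφ] at h1
  have hnk : n = 2 * k := by omega
  have hrev : ∀ i ≤ k, φ (y i) = y (n - i) := by
    intro i
    induction i with
    | zero => intro _; simpa using hφ
    | succ i ih =>
      intro hi
      have h2 := ih (by omega)
      have h3 : T.Adj (y (n - i)) (φ (y (i + 1))) := by
        rw [← h2]; exact φ.map_adj_iff.2 (h.adj i (by omega))
      have h4 : T.Adj (y (n - i)) (y (n - (i + 1))) := by
        have := h.adj (n - (i + 1)) (by omega)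
        rw [show n - (i + 1) + 1 = n - i by omega] at this
        exact this.symm
      have h5 := hφc (y (i + 1))
      have h6 := hl (i + 1) hi
      have h7 := hr (n - i) (by omega) (by omega)
      have h8 := hr (n - (i + 1)) (by omega) (by omega)
      exact parent_unique hT (r := c) h3 h4 (by omega) (by omega)
  rcases Nat.eq_zero_or_pos k with rfl | hkpos
  · refine ⟨Iso.refl, fun v => rfl, ?_, 0, by omega, fun v hv => absurd rfl hv⟩
    intro i hi
    obtain rfl : i = 0 := by omega
    simp [hnk]
  · have hfix : φ (y k) = y k := by rw [hrev k le_rfl]; congr 1; omega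
    have hstep : φ (y (k - 1)) = y (k + 1) := by
      rw [hrev (k - 1) (by omega)]; congr 1; omega
    have hadj1 : T.Adj (y k) (y (k - 1)) := by
      have := h.adj (k - 1) (by omega)
      rw [show k - 1 + 1 = k by omega] at this
      exact this.symm
    have hne : y (k - 1) ≠ y (k + 1) := by
      have := h.ne (k - 1) (by omega)
      rwa [show k - 1 + 2 = k + 1 by omega] at this
    obtain ⟨ψ, hψ1, hψ2, hψ3⟩ := exists_branch_swap hT φ hfix hstep hne hadj1
    have hlt : ∀ i < k, ψ (y i) = y (n - i) := by
      intro i hi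
      rw [hψ2, hrev i (by omega)]
      rw [h.dist_eq hT (i := i) (j := k - 1) (by omega) (by omega),
        h.dist_eq hT (i := i) (j := k) (by omega) (by omega)]
      omega
    refine ⟨ψ, hψ1, ?_, k, hk, ?_⟩
    · intro i hi
      rcases lt_trichotomy i k with h2 | rfl | h2
      · exact hlt i h2
      · rw [show n - i = i by omega]
        exact hψ3 _ (by simp) (by simp)
      · have := hlt (n - i) (by omega)
        rw [show n - (n - i) = i by omega] at this
        rw [← this, hψ1]
    · intro v hv
      by_cases h2 : T.dist v (y (k - 1)) < T.dist v (y k)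
      · exact ⟨k - 1, by omega, hadj1, h2, by rw [hl (k - 1) (by omega)]; omega⟩
      · by_cases h3 : T.dist v (y (k + 1)) < T.dist v (y k)
        · exact ⟨k + 1, by omega, h.adj k (by omega), h3, by
            rw [hr (k + 1) (by omega) (by omega)]; omega⟩
        · exact absurd (hψ3 v h2 h3) hv

/-- The ends lie on opposite sides of the inverted edge and equally far from it, so it is the middle
edge of the path. -/
lemma exists_reflection_of_inverted (h : IsNonbacktracking T y n) (hT : T.IsTree) (φ : T ≃g T)
    {c c' : V} (hc : φ c = c') (hc' : φ c' = c) (hcc : T.Adj c c') (hφ : φ (y 0) = y n)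
    (hlt : T.dist c (y 0) < T.dist c' (y 0)) :
    ∃ ψ : T ≃g T, (∀ v, ψ (ψ v) = v) ∧ (∀ i ≤ n, ψ (y i) = y (n - i)) ∧ ∃ k ≤ n, y k = c := by
  obtain ⟨k, hk, hr, hl⟩ := h.exists_valley hT c
  have hφc : ∀ v, T.dist c' (φ v) = T.dist c v := by
    intro v
    rw [← dist_iso φ c v, hc]
  have hφc' : ∀ v, T.dist c (φ v) = T.dist c' v := by
    intro v
    rw [← dist_iso φ c' v, hc']
  have e1 := hφc (y 0)
  have e2 := hφc' (y 0)
  rw [hφ] at e1 e2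
  have e3 := dist_lt_or_gt hT (y 0) hcc
  rw [SimpleGraph.dist_comm (u := y 0), SimpleGraph.dist_comm (u := y 0)] at e3
  have e4 := dist_across_edge hT hcc (v := y 0) (w := y n)
    (by rwa [SimpleGraph.dist_comm, SimpleGraph.dist_comm (u := y 0)])
    (by rw [SimpleGraph.dist_comm, SimpleGraph.dist_comm (u := y n)]; omega)
  rw [h.dist_eq hT (Nat.zero_le n) le_rfl, SimpleGraph.dist_comm (u := y 0)] at e4
  have h0 := hl 0 (by omega)
  have hn := hr n hk le_rfl
  have hnk : n = 2 * k + 1 := by omega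
  have hyk : y k = c := by
    have : T.dist c (y k) = 0 := by omega
    exact ((hT.connected.dist_eq_zero_iff).1 this).symm
  have hyk' : y (k + 1) = c' := by
    have h1 := h.adj k (by omega)
    have h2 := h.dist_eq' hT (i := k) (j := n) (by omega) le_rfl
    have h3 := h.dist_eq' hT (i := k + 1) (j := n) (by omega) le_rfl
    rw [hyk] at h1 h2
    have h4 : T.dist (y n) c' = T.dist c' (y n) := SimpleGraph.dist_comm
    exact parent_unique hT (r := y n) h1 hcc (by omega) (by omega)
  have hrev : ∀ i ≤ k, φ (y i) = y (n - i) := by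
    intro i
    induction i with
    | zero => intro _; simpa using hφ
    | succ i ih =>
      intro hi
      have h2 := ih (by omega)
      have h3 : T.Adj (y (n - i)) (φ (y (i + 1))) := by
        rw [← h2]; exact φ.map_adj_iff.2 (h.adj i (by omega))
      have h4 : T.Adj (y (n - i)) (y (n - (i + 1))) := by
        have := h.adj (n - (i + 1)) (by omega)
        rw [show n - (i + 1) + 1 = n - i by omega] at this
        exact this.symm
      have h5 := hφc (y (i + 1))
      have h6 := hl (i + 1) hi
      have h7 := h.dist_eq hT (i := k + 1) (j := n - i) (by omega) (by omega)
      have h8 := h.dist_eq hT (i := k + 1) (j := n - (i + 1)) (by omega) (by omega)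
      rw [hyk'] at h7 h8
      exact parent_unique hT (r := c') h3 h4 (by omega) (by omega)
  obtain ⟨ψ, hψ1, hψ2⟩ := exists_edge_swap hT φ hc hc' hcc
  have hlt' : ∀ i ≤ k, ψ (y i) = y (n - i) := by
    intro i hi
    rw [hψ2, hrev i (by omega)]
    rw [← hyk, ← hyk', h.dist_eq hT (i := i) (j := k) (by omega) (by omega),
      h.dist_eq hT (i := i) (j := k + 1) (by omega) (by omega)]
    omega
  refine ⟨ψ, hψ1, ?_, k, hk, hyk⟩
  intro i hi
  rcases le_or_gt i k with h2 | h2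
  · exact hlt' i h2
  · have := hlt' (n - i) (by omega)
    rw [show n - (n - i) = i by omega] at this
    rw [← this, hψ1]

/-- If an automorphism of a tree maps the first vertex of a path to the last one, then there is an
involutive automorphism that reverses the path and moves only vertices hanging below the middle of
the path, as seen from a center `c` of the tree. -/
lemma exists_reflection (h : IsNonbacktracking T y n) (hT : T.IsTree) {c : V}
    (hc : ∀ φ : T ≃g T, φ c = c ∨ (T.Adj c (φ c) ∧ φ (φ c) = c)) (φ : T ≃g T)
    (hφ : φ (y 0) = y n) :
    ∃ ψ : T ≃g T, (∀ v, ψ (ψ v) = v) ∧ (∀ i ≤ n, ψ (y i) = y (n - i)) ∧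
      ((∃ k ≤ n, y k = c) ∨ ∃ k ≤ n, ∀ v, ψ v ≠ v → ∃ j ≤ n, T.Adj (y k) (y j) ∧
        T.dist v (y j) < T.dist v (y k) ∧ T.dist c (y k) < T.dist c (y j)) := by
  rcases hc φ with h1 | ⟨h1, h2⟩
  · obtain ⟨ψ, a1, a2, a3⟩ := h.exists_reflection_of_fixed hT φ h1 hφ
    exact ⟨ψ, a1, a2, Or.inr a3⟩
  · have h3 := dist_lt_or_gt hT (y 0) h1
    rw [SimpleGraph.dist_comm (u := y 0), SimpleGraph.dist_comm (u := y 0)] at h3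
    rcases h3 with h3 | h3
    -- Here `y 0` lies on the side of `φ c`; reversing the path and inverting `φ` puts the first
    -- vertex on the side of `c`.
    · have hφ' : φ.symm (y n) = y 0 := by rw [← hφ]; simp
      have hs : φ.symm c = φ c := by rw [← φ.injective.eq_iff, h2]; simp
      have e1 : T.dist c (y n) = T.dist (φ c) (y 0) := by
        rw [← hφ]; conv_lhs => rw [← h2]
        exact dist_iso φ _ _
      have e2 : T.dist (φ c) (y n) = T.dist c (y 0) := by
        rw [← hφ]; exact dist_iso φ _ _
      obtain ⟨ψ, a1, a2, k, hk, a3⟩ := h.reverse.exists_reflection_of_inverted hT φ.symm hs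
        (by simp) h1 (by simpa using hφ') (by simp only [Nat.sub_zero]; omega)
      refine ⟨ψ, a1, ?_, Or.inl ⟨n - k, by omega, a3⟩⟩
      intro i hi
      have := a2 (n - i) (by omega)
      rwa [show n - (n - i) = i by omega] at this
    · obtain ⟨ψ, a1, a2, a3⟩ := h.exists_reflection_of_inverted hT φ rfl h2 h1 hφ (by omega)
      exact ⟨ψ, a1, a2, Or.inl a3⟩

end IsNonbacktracking

lemma exists_sequence_of_embedding {n : ℕ} (x : pathGraph (n + 1) ↪g T) :
    ∃ y : ℕ → V, IsNonbacktracking T y n ∧ ∀ i : Fin (n + 1), x i = y i := by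
  -- Beyond `n` the sequence stays at the last vertex, a mere default value.
  refine ⟨fun i => x ⟨min i n, by omega⟩, ⟨?_, ?_⟩, ?_⟩
  · intro i hi
    rw [x.map_adj_iff, pathGraph_adj]
    simp; omega
  · intro i hi h
    have := congrArg Fin.val (x.injective h)
    simp at this
    omega
  · intro i
    congr 1
    ext
    simp; omega

lemma nonempty_component_iso {W W' : Type*} {G : SimpleGraph W} {G' : SimpleGraph W'} (e : G ≃g G')
    {u : W} {u' : W'} (h : e u = u') :
    Nonempty ((G.connectedComponentMk u).toSimpleGraph ≃g
      (G'.connectedComponentMk u').toSimpleGraph) := by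
  subst h
  refine ⟨⟨e.toEquiv.subtypeEquiv fun a => ?_, ?_⟩⟩
  · change _ ∈ (G.connectedComponentMk u).supp ↔ _ ∈ (G'.connectedComponentMk (e u)).supp
    simp only [ConnectedComponent.mem_supp_iff, ConnectedComponent.eq]
    exact e.reachable_iff.symm
  · intro a b
    exact e.map_adj_iff (v := a.1) (w := b.1)

/-- A reversing automorphism fixes the middle vertex or inverts the middle edge, so it survives the
deletion and exchanges the two components. -/
lemma halvesCondition_of_reversing {ℓ : ℕ} (x : pathGraph ℓ ↪g T) (ψ : T ≃g T)
    (hψ : ∀ i j : Fin ℓ, i.val + j.val + 1 = ℓ → ψ (x i) = x j) : HalvesCondition T x where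
  odd i j k hij hjk hl := by
    have hj : ψ (x j) = x j := hψ j j (by omega)
    have hi : ψ (x i) = x k := hψ i k (by omega)
    let e : T.induce {x j}ᶜ ≃g T.induce {x j}ᶜ :=
      { toEquiv := ψ.toEquiv.subtypeEquiv fun a => by
          simp only [Set.mem_compl_iff, Set.mem_singleton_iff]
          conv_rhs => rw [← hj]
          exact not_congr ψ.injective.eq_iff.symm
        map_rel_iff' := fun {a b} => ψ.map_adj_iff (v := a.1) (w := b.1) }
    exact nonempty_component_iso e (Subtype.ext hi)
  even i j hij hl := by
    have hi : ψ (x i) = x j := hψ i j (by omega)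
    have hj : ψ (x j) = x i := hψ j i (by omega)
    let e : T.deleteEdges {s(x i, x j)} ≃g T.deleteEdges {s(x i, x j)} :=
      { toEquiv := ψ.toEquiv
        map_rel_iff' := fun {a b} => by
          change (T.deleteEdges _).Adj (ψ a) (ψ b) ↔ _
          simp only [deleteEdges_adj, Set.mem_singleton_iff]
          have h1 : s(ψ a, ψ b) = s(x i, x j) ↔ s(a, b) = s(x i, x j) := by
            have hs : s(x i, x j) = Sym2.map ψ s(x i, x j) := by
              rw [Sym2.map_mk, hi, hj, Sym2.eq_swap]
            conv_lhs => rw [hs, ← Sym2.map_mk]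
            exact (Sym2.map.injective ψ.injective).eq_iff
          rw [h1]
          exact and_congr_left fun _ => ψ.map_adj_iff }
    exact nonempty_component_iso e hi
  swap a b ha hb := ⟨ψ, hψ a b (by omega), hψ b a (by omega)⟩

/-! ### Linear subgraphs, their components and transversals -/

/-- `v` has at most one neighbor. -/
def IsEnd (H : SimpleGraph V) (v : V) : Prop :=
  ∀ a b, H.Adj v a → H.Adj v b → a = b

lemma exists_two_neighbors_of_not_isEnd {v : V} (h : ¬ IsEnd H v) :
    ∃ a b, a ≠ b ∧ H.Adj v a ∧ H.Adj v b := by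
  simp only [IsEnd, not_forall] at h
  obtain ⟨a, b, ha, hb, hab⟩ := h
  exact ⟨a, b, hab, ha, hb⟩

/-- `H` is a subgraph of `T` in which no vertex has three neighbors. -/
structure IsLinear (T H : SimpleGraph V) : Prop where
  le : H ≤ T
  deg : ∀ v a b c, H.Adj v a → H.Adj v b → H.Adj v c → a = b ∨ a = c ∨ b = c

/-- A path of `H` is a path of `T`, hence a geodesic; its second vertex is the parent seen from `s`.
-/
lemma exists_parent_of_reachable (hT : T.IsTree) (hle : H ≤ T) {s v : V} (h : H.Reachable v s)
    (hne : v ≠ s) : ∃ z, H.Adj v z ∧ T.dist s v = T.dist s z + 1 := by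
  obtain ⟨p, hp⟩ := h.exists_isPath
  have key : ∀ {a b : V} (q : H.Walk a b), q.IsPath → q.length = T.dist a b := by
    intro a b q hq
    obtain ⟨r, hr, hr'⟩ := hT.connected.exists_path_of_dist a b
    rw [← hr', ← (hT.existsUnique_path a b).unique (hq.mapLe hle) hr]
    simp
  cases p with
  | nil => exact absurd rfl hne
  | @cons _ z _ hvz q =>
    refine ⟨z, hvz, ?_⟩
    have h1 := key _ hp
    have h2 := key _ hp.of_cons
    rw [Walk.length_cons] at h1
    rw [SimpleGraph.dist_comm, ← h1, SimpleGraph.dist_comm, ← h2]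

/-- This is what makes the components of `H` induced in `T`: the parent of `u` within its component,
seen from the adjacent vertex `v`, has distance zero from `v`. -/
lemma adj_of_reachable_of_adj (hT : T.IsTree) (hle : H ≤ T) {u v : V} (h : H.Reachable u v)
    (huv : T.Adj u v) : H.Adj u v := by
  obtain ⟨z, hz, hd⟩ := exists_parent_of_reachable hT hle h huv.ne
  have h1 : T.dist v u = 1 := by simpa using huv.symm
  have h2 : T.dist v z = 0 := by omega
  rwa [(hT.connected.dist_eq_zero_iff).1 h2]

/-- The vertex of the component of `v` farthest from `v` is an end. -/
lemma exists_far_end [Finite V] (hT : T.IsTree) (hle : H ≤ T) (v : V) :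
    ∃ u, H.Reachable v u ∧ IsEnd H u ∧ ((∃ w, H.Adj v w) → u ≠ v) := by
  obtain ⟨u, hu, hmax⟩ := Set.exists_max_image {u | H.Reachable v u} (T.dist v) (Set.toFinite _)
    ⟨v, Reachable.refl v⟩
  refine ⟨u, hu, ?_, ?_⟩
  · intro a b ha hb
    have h1 := hmax a (Reachable.trans hu ha.reachable)
    have h2 := hmax b (Reachable.trans hu hb.reachable)
    have h3 := dist_lt_or_gt hT v (hle ha)
    have h4 := dist_lt_or_gt hT v (hle hb)
    exact parent_unique hT (r := v) (hle ha) (hle hb) (by omega) (by omega)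
  · rintro ⟨w, hw⟩ rfl
    have h1 := hmax w hw.reachable
    have h2 : T.dist u w = 1 := by simpa using hle hw
    rw [SimpleGraph.dist_self] at h1
    omega

/-- Join the end farthest from `v` to the end farthest from that one. No edge of `H` leaves this
path, because its interior vertices have used up their two neighbors and its ends their only one. -/
lemma IsLinear.exists_enumeration [Finite V] (hH : IsLinear T H) (hT : T.IsTree) (v : V) :
    ∃ (n : ℕ) (y : ℕ → V), IsNonbacktracking T y n ∧ (∀ i < n, H.Adj (y i) (y (i + 1))) ∧
      (∀ w, H.Reachable v w ↔ ∃ i ≤ n, y i = w) ∧ IsEnd H (y 0) ∧ IsEnd H (y n) := by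
  obtain ⟨e, hve, he, -⟩ := exists_far_end hT hH.le v
  obtain ⟨u, heu, hu, hue⟩ := exists_far_end hT hH.le e
  obtain ⟨p, hp⟩ := heu.exists_isPath
  have hadj : ∀ i < p.length, H.Adj (p.getVert i) (p.getVert (i + 1)) :=
    fun i hi => p.adj_getVert_succ hi
  have hne : ∀ i, i + 1 < p.length → p.getVert i ≠ p.getVert (i + 2) := by
    intro i hi h
    have := hp.getVert_injOn (by simp; omega) (by simp; omega) h
    omega
  refine ⟨p.length, p.getVert, ⟨fun i hi => hH.le (hadj i hi), hne⟩, hadj, ?_, by simpa using he,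
    by simpa using hu⟩
  have hclosed : ∀ i ≤ p.length, ∀ z, H.Adj (p.getVert i) z → ∃ j ≤ p.length, p.getVert j = z := by
    intro i hi z hz
    rcases Nat.eq_zero_or_pos i with rfl | hpos
    · rcases Nat.eq_zero_or_pos p.length with h0 | h0
      · rw [Walk.getVert_zero] at hz
        exact absurd (Walk.eq_of_length_eq_zero h0).symm (hue ⟨z, hz⟩)
      · have h1 := hadj 0 h0
        rw [Walk.getVert_zero] at h1 hz
        exact ⟨1, h0, he _ _ h1 hz⟩
    · have h1 := hadj (i - 1) (by omega)
      rw [show i - 1 + 1 = i by omega] at h1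
      rcases eq_or_lt_of_le hi with rfl | hlt
      · rw [Walk.getVert_length] at hz h1
        exact ⟨p.length - 1, by omega, hu _ _ h1.symm hz⟩
      · have h2 := hadj i hlt
        have h3 := hne (i - 1) (by omega)
        rw [show i - 1 + 2 = i + 1 by omega] at h3
        rcases hH.deg _ _ _ _ h1.symm h2 hz with h | h | h
        · exact absurd h h3
        · exact ⟨i - 1, by omega, h⟩
        · exact ⟨i + 1, by omega, h⟩
  intro w
  constructor
  · intro hw
    have hew := hve.symm.trans hw
    rw [reachable_iff_reflTransGen] at hew
    induction hew with
    | refl => exact ⟨0, by omega, by simp⟩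
    | tail _ hbc ih =>
      obtain ⟨i, hi, rfl⟩ := ih ((hw.trans hbc.symm.reachable))
      exact hclosed i hi _ hbc
  · rintro ⟨i, hi, rfl⟩
    exact hve.trans (p.take i).reachable

/-- A vertex set with exactly one vertex in each component of `H`. -/
structure IsTransversal (H : SimpleGraph V) (S : Finset V) : Prop where
  exists_reachable : ∀ v, ∃ s ∈ S, H.Reachable v s
  unique : ∀ s ∈ S, ∀ t ∈ S, H.Reachable s t → s = t

open Classical in
-- Each component is rooted at its element of `S`: `r` is the root and `p` the parent. On `S` itself
-- `p` carries no information.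
lemma IsTransversal.exists_parent {S : Finset V} (hS : IsTransversal H S) (hT : T.IsTree)
    (hle : H ≤ T) : ∃ (r p : V → V), (∀ v, r v ∈ S) ∧ (∀ v, H.Reachable v (r v)) ∧
      (∀ u v, H.Adj u v → r u = r v) ∧
      ∀ v, v ∉ S → H.Adj v (p v) ∧ T.dist (r v) v = T.dist (r v) (p v) + 1 := by
  choose r hr1 hr2 using hS.exists_reachable
  have : ∀ v, ∃ z, v ∉ S → H.Adj v z ∧ T.dist (r v) v = T.dist (r v) z + 1 := by
    intro v
    by_cases h : v ∈ S
    · exact ⟨v, fun h' => absurd h h'⟩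
    · obtain ⟨z, hz⟩ := exists_parent_of_reachable hT hle (hr2 v)
        (fun h' => h (h' ▸ hr1 v))
      exact ⟨z, fun _ => hz⟩
  choose p hp using this
  exact ⟨r, p, hr1, hr2, fun u v huv => hS.unique _ (hr1 u) _ (hr1 v)
    ((hr2 u).symm.trans (huv.reachable.trans (hr2 v))), hp⟩

/-- Sending a vertex outside `S` to the edge towards its parent is a bijection onto the edges of
`H`. -/
lemma IsTransversal.card_add [Fintype V] {S : Finset V} (hS : IsTransversal H S)
    (hT : T.IsTree) (hle : H ≤ T) : S.card + H.edgeSet.ncard = Fintype.card V := by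
  classical
  obtain ⟨r, p, hr, hr2, hrr, hp⟩ := hS.exists_parent hT hle
  have himg : H.edgeSet = (fun v => s(v, p v)) '' ((Sᶜ : Finset V) : Set V) := by
    ext e
    induction e using Sym2.ind with
    | _ a b =>
      simp only [mem_edgeSet, Set.mem_image, Finset.mem_coe, Finset.mem_compl]
      constructor
      · intro hab
        have key : ∀ a b, H.Adj a b → T.dist (r a) a = T.dist (r a) b + 1 →
            ∃ x, x ∉ S ∧ s(x, p x) = s(a, b) := by
          intro a b hab h
          have ha : a ∉ S := by
            intro ha
            have h1 : a = r a := hS.unique _ ha _ (hr a) (hr2 a)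
            rw [← h1, SimpleGraph.dist_self] at h
            omega
          refine ⟨a, ha, ?_⟩
          obtain ⟨h1, h2⟩ := hp a ha
          rw [parent_unique hT (hle h1) (hle hab) (r := r a) (by omega) (by omega)]
        rcases dist_lt_or_gt hT (r a) (hle hab) with h | h
        · exact key a b hab h
        · rw [Sym2.eq_swap]
          exact key b a hab.symm (by rw [← hrr a b hab]; exact h)
      · rintro ⟨v, hv, h⟩
        rw [← mem_edgeSet, ← h, mem_edgeSet]
        exact (hp v hv).1
  have hinj : Set.InjOn (fun v => s(v, p v)) ((Sᶜ : Finset V) : Set V) := by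
    intro v hv w hw h
    simp only [Finset.coe_compl, Set.mem_compl_iff, Finset.mem_coe] at hv hw
    simp only [Sym2.eq_iff] at h
    rcases h with ⟨h, -⟩ | ⟨h1, h2⟩
    · exact h
    · obtain ⟨a1, a2⟩ := hp v hv
      obtain ⟨b1, b2⟩ := hp w hw
      have h3 := hrr _ _ a1
      rw [h2] at h3 a2
      rw [← h1, ← h3] at b2
      omega
  rw [himg, hinj.ncard_image, Set.ncard_coe_finset, Finset.card_compl]
  have := S.card_le_univ
  omega

/-- A transversal consisting of ends of the components. -/
structure IsChoice (H : SimpleGraph V) (S : Finset V) : Prop extends IsTransversal H S where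
  isEnd : ∀ v ∈ S, IsEnd H v

lemma IsChoice.replace [DecidableEq V] {S : Finset V} (hS : IsChoice H S) {u v : V} (hu : u ∈ S)
    (hv : IsEnd H v) (huv : H.Reachable u v) : IsChoice H (insert v (S.erase u)) where
  exists_reachable w := by
    obtain ⟨s, hs, hws⟩ := hS.exists_reachable w
    by_cases h : s = u
    · subst h
      exact ⟨v, by simp, hws.trans huv⟩
    · exact ⟨s, by simp [h, hs], hws⟩
  unique := by
    have key : ∀ s ∈ S, s ≠ u → ¬ H.Reachable s v := fun s hs hsu h =>
      hsu (hS.unique s hs u hu (h.trans huv.symm))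
    intro s hs t ht hst
    simp only [Finset.mem_insert, Finset.mem_erase] at hs ht
    rcases hs with rfl | ⟨hs1, hs2⟩ <;> rcases ht with rfl | ⟨ht1, ht2⟩
    · rfl
    · exact absurd hst.symm (key t ht2 ht1)
    · exact absurd hst (key s hs2 hs1)
    · exact hS.unique s hs2 t ht2 hst
  isEnd w hw := by
    simp only [Finset.mem_insert, Finset.mem_erase] at hw
    rcases hw with rfl | ⟨-, hw⟩
    · exact hv
    · exact hS.isEnd w hw

lemma exists_isChoice [Fintype V] (hT : T.IsTree) (hle : H ≤ T) :
    ∃ S : Finset V, IsChoice H S := by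
  classical
  have : ∀ C : H.ConnectedComponent, ∃ v, H.connectedComponentMk v = C ∧ IsEnd H v := by
    intro C
    induction C using ConnectedComponent.ind with
    | _ v =>
      obtain ⟨u, h1, h2, -⟩ := exists_far_end hT hle v
      exact ⟨u, ConnectedComponent.sound h1.symm, h2⟩
  choose f hf1 hf2 using this
  refine ⟨Finset.univ.image fun v => f (H.connectedComponentMk v), ⟨⟨?_, ?_⟩, ?_⟩⟩
  · intro v
    exact ⟨_, Finset.mem_image_of_mem _ (Finset.mem_univ v),
      ConnectedComponent.exact (hf1 _).symm⟩
  · intro s hs t ht hst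
    simp only [Finset.mem_image, Finset.mem_univ, true_and] at hs ht
    obtain ⟨v, rfl⟩ := hs
    obtain ⟨w, rfl⟩ := ht
    have := ConnectedComponent.sound hst
    rw [hf1, hf1] at this
    rw [this]
  · intro v hv
    simp only [Finset.mem_image, Finset.mem_univ, true_and] at hv
    obtain ⟨w, rfl⟩ := hv
    exact hf2 _

lemma exists_isChoice_mem [Fintype V] (hT : T.IsTree) (hle : H ≤ T) {v : V} (hv : IsEnd H v) :
    ∃ S : Finset V, IsChoice H S ∧ v ∈ S := by
  classical
  obtain ⟨S, hS⟩ := exists_isChoice hT hle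
  obtain ⟨s, hs, hvs⟩ := hS.exists_reachable v
  exact ⟨_, hS.replace hs hv hvs.symm, by simp⟩

/-! ### Path covers as linear subgraphs -/

/-- The edges of `T` inside the parts of `P`. -/
def partsGraph (T : SimpleGraph V) (P : Finset (Finset V)) : SimpleGraph V where
  Adj u v := T.Adj u v ∧ ∃ A ∈ P, u ∈ A ∧ v ∈ A
  symm := ⟨fun _ _ ⟨h, A, hA, hu, hv⟩ => ⟨h.symm, A, hA, hv, hu⟩⟩
  loopless := ⟨fun _ h => h.1.ne rfl⟩

lemma exists_sequence_of_isInducedPath {A : Finset V} (h : IsInducedPath T A) :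
    ∃ (n : ℕ) (y : ℕ → V), IsNonbacktracking T y n ∧ ∀ v, v ∈ A ↔ ∃ i ≤ n, y i = v := by
  obtain ⟨⟨a, ha⟩, ℓ, x, hx⟩ := h
  have hmem : ∀ v, v ∈ A ↔ ∃ i, x i = v := fun v => by
    rw [← Finset.mem_coe, ← hx]; rfl
  cases ℓ with
  | zero =>
    obtain ⟨i, -⟩ := (hmem a).1 ha
    exact i.elim0
  | succ n =>
    obtain ⟨y, hy, hxy⟩ := exists_sequence_of_embedding x
    refine ⟨n, y, hy, fun v => (hmem v).trans ⟨?_, ?_⟩⟩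
    · rintro ⟨i, rfl⟩
      exact ⟨i, by omega, (hxy i).symm⟩
    · rintro ⟨i, hi, rfl⟩
      exact ⟨⟨i, by omega⟩, hxy _⟩

namespace IsPathCover

lemma eq_of_mem (hP : IsPathCover T P) {A B : Finset V} (hA : A ∈ P) (hB : B ∈ P) {v : V}
    (hvA : v ∈ A) (hvB : v ∈ B) : A = B := by
  by_contra h
  exact Finset.disjoint_left.1 (hP.disjoint A hA B hB h) hvA hvB

lemma adj_iff (hP : IsPathCover T P) {A : Finset V} (hA : A ∈ P) {v w : V} (hv : v ∈ A) :
    (partsGraph T P).Adj v w ↔ T.Adj v w ∧ w ∈ A := by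
  constructor
  · rintro ⟨h, B, hB, hvB, hwB⟩
    rw [hP.eq_of_mem hA hB hv hvB]
    exact ⟨h, hwB⟩
  · rintro ⟨h, hw⟩
    exact ⟨h, A, hA, hv, hw⟩

lemma reachable_iff (hP : IsPathCover T P) {A : Finset V} (hA : A ∈ P) {v w : V} (hv : v ∈ A) :
    (partsGraph T P).Reachable v w ↔ w ∈ A := by
  constructor
  · intro h
    rw [reachable_iff_reflTransGen] at h
    induction h with
    | refl => exact hv
    | tail _ hbc ih => exact ((hP.adj_iff hA ih).1 hbc).2
  · obtain ⟨n, y, hy, hmem⟩ := exists_sequence_of_isInducedPath (hP.isInducedPath A hA)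
    have key : ∀ i ≤ n, (partsGraph T P).Reachable (y 0) (y i) := by
      intro i
      induction i with
      | zero => intro _; rfl
      | succ i ih =>
        intro hi
        refine (ih (by omega)).trans (Adj.reachable ⟨hy.adj i (by omega), A, hA, ?_, ?_⟩)
        · exact (hmem _).2 ⟨i, by omega, rfl⟩
        · exact (hmem _).2 ⟨i + 1, hi, rfl⟩
    intro hw
    obtain ⟨i, hi, rfl⟩ := (hmem v).1 hv
    obtain ⟨j, hj, rfl⟩ := (hmem w).1 hw
    exact (key i hi).symm.trans (key j hj)

lemma adj_sequence (hP : IsPathCover T P) (hT : T.IsTree) {A : Finset V} (hA : A ∈ P) {n : ℕ}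
    {y : ℕ → V} (hy : IsNonbacktracking T y n) (hmem : ∀ v, v ∈ A ↔ ∃ i ≤ n, y i = v) {i : ℕ}
    (hi : i ≤ n) {w : V} (h : (partsGraph T P).Adj (y i) w) :
    ∃ j ≤ n, y j = w ∧ (i + 1 = j ∨ j + 1 = i) := by
  obtain ⟨h1, h2⟩ := (hP.adj_iff hA ((hmem _).2 ⟨i, hi, rfl⟩)).1 h
  obtain ⟨j, hj, rfl⟩ := (hmem w).1 h2
  refine ⟨j, hj, rfl, ?_⟩
  rw [← dist_eq_one_iff_adj] at h1
  rcases le_total i j with hij | hij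
  · rw [hy.dist_eq hT hij hj] at h1; omega
  · rw [hy.dist_eq' hT hij hi] at h1; omega

lemma isLinear (hP : IsPathCover T P) (hT : T.IsTree) : IsLinear T (partsGraph T P) where
  le _ _ h := h.1
  deg v a b c ha hb hc := by
    obtain ⟨A, hA, hv⟩ := hP.cover v
    obtain ⟨n, y, hy, hmem⟩ := exists_sequence_of_isInducedPath (hP.isInducedPath A hA)
    obtain ⟨i, hi, rfl⟩ := (hmem v).1 hv
    obtain ⟨j, -, rfl, hj⟩ := hP.adj_sequence hT hA hy hmem hi ha
    obtain ⟨k, -, rfl, hk⟩ := hP.adj_sequence hT hA hy hmem hi hb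
    obtain ⟨l, -, rfl, hl⟩ := hP.adj_sequence hT hA hy hmem hi hc
    have : j = k ∨ j = l ∨ k = l := by omega
    rcases this with rfl | rfl | rfl <;> simp

lemma isEnd_first (hP : IsPathCover T P) (hT : T.IsTree) {A : Finset V} (hA : A ∈ P) {n : ℕ}
    {y : ℕ → V} (hy : IsNonbacktracking T y n) (hmem : ∀ v, v ∈ A ↔ ∃ i ≤ n, y i = v) :
    IsEnd (partsGraph T P) (y 0) := by
  intro a b ha hb
  obtain ⟨j, -, rfl, hj⟩ := hP.adj_sequence hT hA hy hmem (Nat.zero_le _) ha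
  obtain ⟨k, -, rfl, hk⟩ := hP.adj_sequence hT hA hy hmem (Nat.zero_le _) hb
  have : j = k := by omega
  rw [this]

lemma isEndVertex_iff (hP : IsPathCover T P) (hT : T.IsTree) {A : Finset V} (hA : A ∈ P) (v : V) :
    IsEndVertex T A v ↔ v ∈ A ∧ IsEnd (partsGraph T P) v := by
  constructor
  · rintro ⟨n, x, hx, rfl⟩
    obtain ⟨y, hy, hxy⟩ := exists_sequence_of_embedding x
    have hmem : ∀ v, v ∈ A ↔ ∃ i ≤ n, y i = v := by
      intro v
      rw [← Finset.mem_coe, ← hx, Set.mem_range]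
      constructor
      · rintro ⟨i, rfl⟩
        exact ⟨i, by omega, (hxy i).symm⟩
      · rintro ⟨i, hi, rfl⟩
        exact ⟨⟨i, by omega⟩, hxy _⟩
    have h0 : x 0 = y 0 := hxy 0
    rw [h0]
    exact ⟨(hmem _).2 ⟨0, by omega, rfl⟩, hP.isEnd_first hT hA hy hmem⟩
  · rintro ⟨hv, he⟩
    have key : ∀ (n : ℕ) (y : ℕ → V), IsNonbacktracking T y n → (∀ v, v ∈ A ↔ ∃ i ≤ n, y i = v) →
        IsEndVertex T A (y 0) := by
      intro n y hy hmem
      obtain ⟨x, hx⟩ := exists_embedding_of_nonbacktracking hT y n hy.adj hy.ne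
      refine ⟨n, x, ?_, hx 0⟩
      ext v
      rw [Set.mem_range, Finset.mem_coe, hmem]
      constructor
      · rintro ⟨i, rfl⟩
        exact ⟨i, by omega, (hx i).symm⟩
      · rintro ⟨i, hi, rfl⟩
        exact ⟨⟨i, by omega⟩, hx _⟩
    obtain ⟨n, y, hy, hmem⟩ := exists_sequence_of_isInducedPath (hP.isInducedPath A hA)
    obtain ⟨i, hi, rfl⟩ := (hmem v).1 hv
    rcases Nat.eq_zero_or_pos i with rfl | hpos
    · exact key n y hy hmem
    rcases eq_or_lt_of_le hi with rfl | hlt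
    · have := key i (fun j => y (i - j)) hy.reverse (by
        intro v
        rw [hmem]
        constructor
        · rintro ⟨j, hj, rfl⟩
          exact ⟨i - j, by omega, show y (i - (i - j)) = y j from congrArg y (by omega)⟩
        · rintro ⟨j, hj, rfl⟩
          exact ⟨i - j, by omega, rfl⟩)
      simpa using this
    · exfalso
      obtain ⟨k, rfl⟩ : ∃ k, i = k + 1 := ⟨i - 1, by omega⟩
      have h1 : (partsGraph T P).Adj (y (k + 1)) (y k) :=
        (hP.adj_iff hA hv).2 ⟨(hy.adj k (by omega)).symm, (hmem _).2 ⟨k, by omega, rfl⟩⟩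
      have h2 : (partsGraph T P).Adj (y (k + 1)) (y (k + 2)) :=
        (hP.adj_iff hA hv).2 ⟨hy.adj (k + 1) (by omega), (hmem _).2 ⟨k + 2, by omega, rfl⟩⟩
      exact hy.ne k (by omega) (he _ _ h1 h2)

/-- One vertex from each path is a transversal. Thus fewer paths means more edges inside paths,
which turns minimum covers into maximum linear subgraphs. -/
lemma card_add [Fintype V] (hP : IsPathCover T P) (hT : T.IsTree) :
    P.card + (partsGraph T P).edgeSet.ncard = Fintype.card V := by
  classical
  have : ∀ A : Finset V, ∃ v, A ∈ P → v ∈ A := by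
    intro A
    by_cases hA : A ∈ P
    · obtain ⟨v, hv⟩ := (hP.isInducedPath A hA).1
      exact ⟨v, fun _ => hv⟩
    · exact ⟨hT.connected.nonempty.some, fun h => absurd h hA⟩
  choose f hf using this
  have hinj : Set.InjOn f P := by
    intro A hA B hB h
    exact hP.eq_of_mem hA hB (hf A hA) (h ▸ hf B hB)
  rw [← Finset.card_image_of_injOn hinj]
  refine IsTransversal.card_add ⟨?_, ?_⟩ hT (hP.isLinear hT).le
  · intro v
    obtain ⟨A, hA, hv⟩ := hP.cover v
    exact ⟨f A, Finset.mem_image_of_mem f hA, (hP.reachable_iff hA hv).2 (hf A hA)⟩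
  · intro s hs t ht hst
    obtain ⟨A, hA, rfl⟩ := Finset.mem_image.1 hs
    obtain ⟨B, hB, rfl⟩ := Finset.mem_image.1 ht
    rw [hP.reachable_iff hA (hf A hA)] at hst
    rw [hP.eq_of_mem hA hB hst (hf B hB)]

end IsPathCover

open Classical in
-- The parts are the components of `H`; no edge of `T` is added inside them because they are
-- induced.
lemma IsLinear.exists_isPathCover [Fintype V] (hH : IsLinear T H) (hT : T.IsTree) :
    ∃ P, IsPathCover T P ∧ partsGraph T P = H := by
  let f : V → Finset V := fun v => Finset.univ.filter fun w => H.Reachable v w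
  have hf : ∀ v w, w ∈ f v ↔ H.Reachable v w := fun v w => by simp [f]
  refine ⟨Finset.univ.image f, ⟨?_, ?_, ?_⟩, ?_⟩
  · intro A hA
    obtain ⟨v, -, rfl⟩ := Finset.mem_image.1 hA
    refine ⟨⟨v, (hf v v).2 Reachable.rfl⟩, ?_⟩
    obtain ⟨n, y, hy, -, hmem, -⟩ := hH.exists_enumeration hT v
    obtain ⟨x, hx⟩ := exists_embedding_of_nonbacktracking hT y n hy.adj hy.ne
    refine ⟨n + 1, x, ?_⟩
    ext w
    rw [Set.mem_range, Finset.mem_coe, hf, hmem]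
    constructor
    · rintro ⟨i, rfl⟩
      exact ⟨i, by omega, (hx i).symm⟩
    · rintro ⟨i, hi, rfl⟩
      exact ⟨⟨i, by omega⟩, hx _⟩
  · intro A hA B hB hAB
    obtain ⟨v, -, rfl⟩ := Finset.mem_image.1 hA
    obtain ⟨w, -, rfl⟩ := Finset.mem_image.1 hB
    rw [Finset.disjoint_left]
    intro z hz hz'
    rw [hf] at hz hz'
    apply hAB
    ext u
    rw [hf, hf]
    exact ⟨fun h => (hz'.trans hz.symm).trans h, fun h => (hz.trans hz'.symm).trans h⟩
  · intro v
    exact ⟨f v, Finset.mem_image_of_mem _ (Finset.mem_univ v), (hf v v).2 Reachable.rfl⟩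
  · ext u v
    constructor
    · rintro ⟨h, A, hA, hu, hv⟩
      obtain ⟨w, -, rfl⟩ := Finset.mem_image.1 hA
      rw [hf] at hu hv
      exact adj_of_reachable_of_adj hT hH.le (hu.symm.trans hv) h
    · intro h
      exact ⟨hH.le h, f u, Finset.mem_image_of_mem _ (Finset.mem_univ u), (hf _ _).2 Reachable.rfl,
        (hf _ _).2 h.reachable⟩

/-- A linear subgraph with the maximum number of edges. -/
structure IsMaxLinear (T H : SimpleGraph V) : Prop extends IsLinear T H where
  ncard_le : ∀ H', IsLinear T H' → H'.edgeSet.ncard ≤ H.edgeSet.ncard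

lemma IsMinPathCover.isMaxLinear [Fintype V] {P : Finset (Finset V)} (hP : IsMinPathCover T P)
    (hT : T.IsTree) : IsMaxLinear T (partsGraph T P) where
  toIsLinear := hP.1.isLinear hT
  ncard_le H' hH' := by
    obtain ⟨P', hP', rfl⟩ := hH'.exists_isPathCover hT
    have h1 := hP.2 P' hP'
    have h2 := hP.1.card_add hT
    have h3 := hP'.card_add hT
    omega

lemma IsMaxLinear.exists_isMinPathCover [Fintype V] (hH : IsMaxLinear T H) (hT : T.IsTree) :
    ∃ P, IsMinPathCover T P ∧ partsGraph T P = H := by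
  obtain ⟨P, hP, rfl⟩ := hH.exists_isPathCover hT
  refine ⟨P, ⟨hP, fun P' hP' => ?_⟩, rfl⟩
  have h1 := hH.ncard_le _ (hP'.isLinear hT)
  have h2 := hP.card_add hT
  have h3 := hP'.card_add hT
  omega

lemma exists_isMaxLinear [Finite V] (T : SimpleGraph V) : ∃ H, IsMaxLinear T H := by
  obtain ⟨H, hH, hmax⟩ := Set.exists_max_image {H | IsLinear T H} (fun H => H.edgeSet.ncard)
    (Set.toFinite _) ⟨⊥, bot_le, fun v a b c h => h.elim⟩
  exact ⟨H, hH, hmax⟩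

/-! ### Zero forcing sets as choices of path ends -/

/-- A stalled process would yield an endless walk without turning back. From an inactive vertex go
to its parent in `H`. If that parent is active but cannot force, it has another inactive neighbor
along an edge outside `H`; go there and on to the parent of that vertex. -/
lemma IsLinear.isZeroForcingSet [Fintype V] [DecidableEq V] (hH : IsLinear T H) (hT : T.IsTree)
    {S : Finset V} (hS : IsChoice H S) : IsZeroForcingSet T S := by
  obtain ⟨r, p, -, -, hrr, hp⟩ := hS.toIsTransversal.exists_parent hT hH.le
  have hpp : ∀ v, v ∉ S → p v ∉ S → p (p v) ≠ v := by
    intro v hv hpv h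
    obtain ⟨a1, a2⟩ := hp v hv
    obtain ⟨b1, b2⟩ := hp _ hpv
    rw [h, ← hrr _ _ a1] at b2
    omega
  -- Keeping `F` closed under parents means that activity spreads along each path outwards from its
  -- element of `S`.
  obtain ⟨F, ⟨hSF, hF, hFp⟩, hmax⟩ := Set.exists_max_image
    {F : Finset V | S ⊆ F ∧ Relation.ReflTransGen (Activates T) S F ∧ ∀ v ∈ F, v ∉ S → p v ∈ F}
    Finset.card (Set.toFinite _) ⟨S, le_rfl, .refl, fun v hv hv' => absurd hv hv'⟩
  suffices hu : F = Finset.univ by rw [hu] at hF; exact hF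
  by_contra hne
  obtain ⟨v₀, hv₀⟩ : ∃ v, v ∉ F := by
    by_contra h
    push Not at h
    exact hne (Finset.eq_univ_iff_forall.2 h)
  have hnS : ∀ v, v ∉ F → v ∉ S := fun v hv h => hv (hSF h)
  refine no_nonbacktracking hT
    (fun a b => (b ∉ F ∧ T.Adj a b ∧ ¬ H.Adj a b) ∨ (a ∉ F ∧ b = p a)) ?_ ?_ v₀ (p v₀)
    (Or.inr ⟨hv₀, rfl⟩)
  · rintro a b (⟨-, h, -⟩ | ⟨ha, rfl⟩)
    · exact h
    · exact hH.le (hp a (hnS a ha)).1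
  · rintro a b (⟨hb, hab, hnab⟩ | ⟨ha, rfl⟩)
    · refine ⟨p b, ?_, Or.inr ⟨hb, rfl⟩⟩
      rintro rfl
      exact hnab (hp b (hnS b hb)).1.symm
    · have haS := hnS a ha
      obtain ⟨hpa, -⟩ := hp a haS
      by_cases hb : p a ∈ F
      · by_contra hno
        push Not at hno
        have hact : Activates T F (insert a F) := by
          refine ⟨p a, hb, a, ha, (hH.le hpa).symm, ?_, rfl⟩
          intro w hw hwa
          by_contra hwF
          have hHw : H.Adj (p a) w := (hno w hwa).1 hwF hw
          -- Besides `a`, the only possible neighbor of `p a` in `H` is its own parent, which is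
          -- active by closure of `F`; if `p a ∈ S` is an end, there is none.
          by_cases hpS : p a ∈ S
          · exact hwa (hS.isEnd _ hpS _ _ hHw hpa.symm)
          · have h1 := hFp _ hb hpS
            rcases hH.deg _ _ _ _ hHw hpa.symm (hp _ hpS).1 with h | h | h
            · exact hwa h
            · exact hwF (h ▸ h1)
            · exact ha (h ▸ h1)
        have := hmax (insert a F) ⟨hSF.trans (Finset.subset_insert _ _), hF.tail hact, by
          intro v hv hvS
          rcases Finset.mem_insert.1 hv with rfl | hv
          · exact Finset.mem_insert_of_mem hb
          · exact Finset.mem_insert_of_mem (hFp v hv hvS)⟩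
        rw [Finset.card_insert_of_notMem ha] at this
        omega
      · exact ⟨p (p a), hpp a haS (hnS _ hb), Or.inr ⟨hb, rfl⟩⟩

lemma sup_edge_adj_iff {a b u v : V} (hab : a ≠ b) :
    (H ⊔ edge a b).Adj u v ↔ H.Adj u v ∨ (a = u ∧ b = v ∨ a = v ∧ b = u) := by
  simp only [sup_adj, edge_adj]
  constructor
  · rintro (h | ⟨h, -⟩)
    · exact Or.inl h
    · right; tauto
  · rintro (h | h)
    · exact Or.inl h
    · right
      refine ⟨by tauto, ?_⟩
      rcases h with ⟨rfl, rfl⟩ | ⟨rfl, rfl⟩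
      · exact hab
      · exact hab.symm

lemma eq_or_eq_or_eq_of_unique (p : V → Prop) (w : V) (hp : ∀ a b, p a → p b → a = b) (a b c : V)
    (ha : p a ∨ a = w) (hb : p b ∨ b = w) (hc : p c ∨ c = w) : a = b ∨ a = c ∨ b = c := by
  rcases ha with ha | ha
  · rcases hb with hb | hb
    · exact Or.inl (hp a b ha hb)
    · rcases hc with hc | hc
      · exact Or.inr (Or.inl (hp a c ha hc))
      · exact Or.inr (Or.inr (hb.trans hc.symm))
  · rcases hb with hb | hb
    · rcases hc with hc | hc
      · exact Or.inr (Or.inr (hp b c hb hc))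
      · exact Or.inr (Or.inl (ha.trans hc.symm))
    · exact Or.inl (ha.trans hb.symm)

lemma IsLinear.sup_edge (hH : IsLinear T H) {u v : V} (huv : T.Adj u v) (hu : IsEnd H u)
    (hv : IsEnd H v) : IsLinear T (H ⊔ edge u v) where
  le := sup_le hH.le ((edge_le_iff _).2 (Or.inr huv))
  deg x a b c ha hb hc := by
    rw [sup_edge_adj_iff huv.ne] at ha hb hc
    by_cases hxu : u = x
    · subst hxu
      have hvu := huv.ne.symm
      have e : ∀ z, (H.Adj u z ∨ (u = u ∧ v = z ∨ u = z ∧ v = u)) → H.Adj u z ∨ z = v := by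
        intro z hz
        rcases hz with hz | ⟨-, hz⟩ | ⟨-, hz⟩
        · exact Or.inl hz
        · exact Or.inr hz.symm
        · exact absurd hz hvu
      exact eq_or_eq_or_eq_of_unique _ v hu a b c (e a ha) (e b hb) (e c hc)
    · by_cases hxv : v = x
      · subst hxv
        have e : ∀ z, (H.Adj v z ∨ (u = v ∧ v = z ∨ u = z ∧ v = v)) → H.Adj v z ∨ z = u := by
          intro z hz
          rcases hz with hz | ⟨hz, -⟩ | ⟨hz, -⟩
          · exact Or.inl hz
          · exact absurd hz hxu
          · exact Or.inr hz.symm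
        exact eq_or_eq_or_eq_of_unique _ u hv a b c (e a ha) (e b hb) (e c hc)
      · have e : ∀ z, (H.Adj x z ∨ (u = x ∧ v = z ∨ u = z ∧ v = x)) → H.Adj x z := by
          intro z hz
          tauto
        exact hH.deg x a b c (e a ha) (e b hb) (e c hc)

/-- The forcing chains of a zero forcing set. -/
lemma exists_isLinear_of_isZeroForcingSet [Fintype V] [DecidableEq V]
    {S : Finset V} (hS : IsZeroForcingSet T S) : ∃ H, IsLinear T H ∧ IsChoice H S := by
  -- `H` records the forces performed so far, and `r` sends an active vertex to the start of its
  -- chain. The last clause says that a vertex with an inactive neighbor has not forced yet: its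
  -- chain stops there, and if it belongs to `S` it is still alone in its chain.
  have key : ∀ F : Finset V, Relation.ReflTransGen (Activates T) S F →
      ∃ (H : SimpleGraph V) (r : V → V), IsLinear T H ∧ S ⊆ F ∧
        (∀ u v, H.Adj u v → u ∈ F ∧ r u = r v) ∧ (∀ s ∈ S, r s = s ∧ IsEnd H s) ∧
        (∀ v ∈ F, r v ∈ S ∧ H.Reachable v (r v)) ∧
        ∀ v ∈ F, ∀ w, w ∉ F → T.Adj v w → IsEnd H v ∧ (v ∈ S → ∀ z, ¬ H.Adj v z) := by
    intro F hF
    induction hF with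
    | refl =>
      refine ⟨⊥, id, ⟨bot_le, fun v a b c h => h.elim⟩, le_rfl, fun u v h => h.elim,
        fun s _ => ⟨rfl, fun a b h => h.elim⟩, fun v hv => ⟨hv, Reachable.rfl⟩,
        fun v _ w _ _ => ⟨fun a b h => h.elim, fun _ z h => h⟩⟩
    | @tail F F' hSF hFF' ih =>
      obtain ⟨H, r, hH, hsub, hadj, hr, hreach, hlast⟩ := ih
      obtain ⟨u, hu, v, hv, huv, hall, rfl⟩ := hFF'
      have hiff := @sup_edge_adj_iff V H u v
      have hHv : ∀ z, ¬ H.Adj v z := fun z h => hv (hadj _ _ h).1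
      have hHv' : ∀ z, ¬ H.Adj z v := fun z h => hHv z h.symm
      obtain ⟨hue, huS⟩ := hlast u hu v hv huv
      have hSv : ∀ s ∈ S, s ≠ v := fun s hs h => hv (h ▸ hsub hs)
      have hadjF : ∀ a b, H.Adj a b → b ≠ v := fun a b h h' => hHv' a (h' ▸ h)
      refine ⟨H ⊔ edge u v, Function.update r v (r u),
        hH.sup_edge huv hue (fun a b ha => absurd ha (hHv a)),
        hsub.trans (Finset.subset_insert _ _), ?_, ?_, ?_, ?_⟩
      · intro a b hab
        rw [hiff huv.ne] at hab
        rcases hab with hab | ⟨rfl, rfl⟩ | ⟨rfl, rfl⟩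
        · obtain ⟨h1, h2⟩ := hadj a b hab
          refine ⟨Finset.mem_insert_of_mem h1, ?_⟩
          rw [Function.update_of_ne (hadjF _ _ hab.symm), Function.update_of_ne (hadjF _ _ hab), h2]
        · refine ⟨Finset.mem_insert_of_mem hu, ?_⟩
          rw [Function.update_self, Function.update_of_ne huv.ne]
        · refine ⟨Finset.mem_insert_self _ _, ?_⟩
          rw [Function.update_self, Function.update_of_ne huv.ne]
      · intro s hs
        rw [Function.update_of_ne (hSv s hs)]
        refine ⟨(hr s hs).1, ?_⟩
        intro a b ha hb
        rw [hiff huv.ne] at ha hb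
        have hsv := (hSv s hs).symm
        by_cases hsu : s = u
        · subst hsu
          have h1 := huS hs
          have e : ∀ z, (H.Adj s z ∨ (s = s ∧ v = z ∨ s = z ∧ v = s)) → v = z := by
            intro z hz
            have := h1 z
            tauto
          rw [← e a ha, ← e b hb]
        · have e : ∀ z, (H.Adj s z ∨ (u = s ∧ v = z ∨ u = z ∧ v = s)) → H.Adj s z := by
            intro z hz
            have := Ne.symm hsu
            tauto
          exact (hr s hs).2 a b (e a ha) (e b hb)
      · have hru : (H ⊔ edge u v).Reachable u (r u) := (hreach u hu).2.mono le_sup_left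
        intro w hw
        rcases Finset.mem_insert.1 hw with rfl | hw
        · rw [Function.update_self]
          refine ⟨(hreach u hu).1, Reachable.trans (Adj.reachable ?_) hru⟩
          rw [hiff huv.ne]
          tauto
        · have : w ≠ v := fun h => hv (h ▸ hw)
          rw [Function.update_of_ne this]
          exact ⟨(hreach w hw).1, (hreach w hw).2.mono le_sup_left⟩
      · intro x hx w hw hxw
        have hwF : w ∉ F := fun h => hw (Finset.mem_insert_of_mem h)
        have hwv : w ≠ v := fun h => hw (h ▸ Finset.mem_insert_self _ _)
        -- Once `u` has forced, all its neighbors are active, so the last clause says nothing about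
        -- `u`.
        have hxu : u ≠ x := by
          rintro rfl
          exact hwF (hall w hxw hwv)
        rcases Finset.mem_insert.1 hx with rfl | hx
        · refine ⟨?_, fun h => absurd rfl (hSv x h)⟩
          intro a b ha hb
          rw [hiff huv.ne] at ha hb
          have e : ∀ z, (H.Adj x z ∨ (u = x ∧ x = z ∨ u = z ∧ x = x)) → u = z := by
            intro z hz
            have := hHv z
            tauto
          rw [← e a ha, ← e b hb]
        · have hxv : v ≠ x := fun h => hv (h ▸ hx)
          have e : ∀ z, (H ⊔ edge u v).Adj x z → H.Adj x z := by
            intro z hz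
            rw [hiff huv.ne] at hz
            tauto
          obtain ⟨h1, h2⟩ := hlast x hx w hwF hxw
          exact ⟨fun a b ha hb => h1 a b (e a ha) (e b hb), fun hxS z hz => h2 hxS z (e z hz)⟩
  obtain ⟨H, r, hH, -, hadj, hr, hreach, -⟩ := key _ hS
  refine ⟨H, hH, ⟨⟨fun v => ⟨r v, hreach v (Finset.mem_univ v)⟩, ?_⟩, fun s hs => (hr s hs).2⟩⟩
  intro s hs t ht hst
  rw [← (hr s hs).1, ← (hr t ht).1]
  rw [reachable_iff_reflTransGen] at hst
  clear ht
  induction hst with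
  | refl => rfl
  | tail _ hbc ih => exact ih.trans (hadj _ _ hbc).2

/-- By `IsTransversal.card_add`, minimizing the size of a choice is the same as maximizing the
number of edges of `H`. -/
lemma isMinZeroForcingSet_iff [Fintype V] [DecidableEq V] (hT : T.IsTree) (S : Finset V) :
    IsMinZeroForcingSet T S ↔ ∃ H, IsMaxLinear T H ∧ IsChoice H S := by
  constructor
  · rintro ⟨hS, hmin⟩
    obtain ⟨H, hH, hHS⟩ := exists_isLinear_of_isZeroForcingSet hS
    refine ⟨H, ⟨hH, fun H' hH' => ?_⟩, hHS⟩
    obtain ⟨S', hS'⟩ := exists_isChoice hT hH'.le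
    have h1 := hmin S' (hH'.isZeroForcingSet hT hS')
    have h2 := hHS.toIsTransversal.card_add hT hH.le
    have h3 := hS'.toIsTransversal.card_add hT hH'.le
    omega
  · rintro ⟨H, hH, hHS⟩
    refine ⟨hH.toIsLinear.isZeroForcingSet hT hHS, fun S' hS' => ?_⟩
    obtain ⟨H', hH', hHS'⟩ := exists_isLinear_of_isZeroForcingSet hS'
    have h1 := hH.ncard_le H' hH'
    have h2 := hHS.toIsTransversal.card_add hT hH.le
    have h3 := hHS'.toIsTransversal.card_add hT hH'.le
    omega

lemma isEnd_iso_iff (φ : T ≃g T) (v : V) : IsEnd T (φ v) ↔ IsEnd T v := by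
  have key : ∀ (φ : T ≃g T) (v : V), IsEnd T (φ v) → IsEnd T v := by
    intro φ v h a b ha hb
    exact φ.injective (h _ _ (φ.map_adj_iff.2 ha) (φ.map_adj_iff.2 hb))
  exact ⟨key φ v, fun h => key φ.symm (φ v) (by simpa using h)⟩

lemma isEnd_iff_degree_eq_one [Fintype V] [Nontrivial V] [DecidableRel T.Adj] (hT : T.IsTree)
    (v : V) : IsEnd T v ↔ T.degree v = 1 := by
  have hpos := hT.connected.preconnected.degree_pos_of_nontrivial v
  rw [← card_neighborFinset_eq_degree] at hpos ⊢
  rw [show (T.neighborFinset v).card = 1 ↔ (T.neighborFinset v).card ≤ 1 by omega,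
    Finset.card_le_one]
  simp only [mem_neighborFinset, IsEnd]
  exact ⟨fun h a ha b hb => h a b ha hb, fun h a b ha hb => h a ha b hb⟩

/-! ### Exchanging edges in maximum linear subgraphs -/

lemma ncard_edgeSet_sup_edge [Finite V] {u v : V} (huv : u ≠ v) (h : ¬ H.Adj u v) :
    (H ⊔ edge u v).edgeSet.ncard = H.edgeSet.ncard + 1 := by
  rw [edgeSet_sup, edgeSet_edge_of_ne huv, Set.union_singleton,
    Set.ncard_insert_of_notMem (by simpa using h) (Set.toFinite _)]

/-- Two ends joined by an edge outside `H` could be linked, which gains an edge. -/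
lemma IsMaxLinear.not_isEnd_of_adj [Finite V] (hH : IsMaxLinear T H) {u v : V} (huv : T.Adj u v)
    (hn : ¬ H.Adj u v) (hu : IsEnd H u) : ¬ IsEnd H v := by
  intro hv
  have := hH.ncard_le _ (hH.toIsLinear.sup_edge huv hu hv)
  rw [ncard_edgeSet_sup_edge huv.ne hn] at this
  omega

/-- Replace the edge `cd` by the edge `bc`. -/
def exchange (H : SimpleGraph V) (b c d : V) : SimpleGraph V :=
  H.deleteEdges {s(c, d)} ⊔ edge b c

lemma exchange_adj_iff {b c d u v : V} (hbc : b ≠ c) : (exchange H b c d).Adj u v ↔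
    (H.Adj u v ∧ s(u, v) ≠ s(c, d)) ∨ (b = u ∧ c = v ∨ b = v ∧ c = u) := by
  rw [exchange, sup_edge_adj_iff hbc, deleteEdges_adj]
  simp

/-- Deleting `cd` turns `c` into an end, which can then be linked to the end `b`; the number of
edges stays the same. -/
lemma IsMaxLinear.exchange [Finite V] (hH : IsMaxLinear T H) {b c d : V} (hbc : T.Adj b c)
    (hn : ¬ H.Adj b c) (hb : IsEnd H b) (hcd : H.Adj c d) :
    IsMaxLinear T (exchange H b c d) := by
  have hle : H.deleteEdges {s(c, d)} ≤ H := deleteEdges_le _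
  have hlin : IsLinear T (H.deleteEdges {s(c, d)}) :=
    ⟨hle.trans hH.le, fun v x y z hx hy hz => hH.deg v x y z (hle hx) (hle hy) (hle hz)⟩
  have hb' : IsEnd (H.deleteEdges {s(c, d)}) b := fun x y hx hy => hb x y (hle hx) (hle hy)
  have hc' : IsEnd (H.deleteEdges {s(c, d)}) c := by
    intro x y hx hy
    rw [deleteEdges_adj] at hx hy
    rcases hH.deg c x y d hx.1 hy.1 hcd with h | rfl | rfl
    · exact h
    · simp at hx
    · simp at hy
  refine ⟨hlin.sup_edge hbc hb' hc', fun H' hH' => ?_⟩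
  have h1 := hH.ncard_le H' hH'
  rw [ZeroForcing.exchange, ncard_edgeSet_sup_edge hbc.ne (fun h => hn (hle h)), edgeSet_deleteEdges,
    Set.ncard_sdiff_singleton_add_one (by simpa using hcd) (Set.toFinite _)]
  exact h1

/-- Reroute two paths joined by an edge of `T` such that the other end of the first path and a
given end of the second path become the ends of one path. -/
lemma IsMaxLinear.exists_rerouting [Finite V] (hH : IsMaxLinear T H) (hT : T.IsTree) {b c e : V}
    (hbc : T.Adj b c) (hn : ¬ H.Adj b c) (hb : IsEnd H b) (hce : H.Reachable c e)
    (he : IsEnd H e) : ∃ H' u, IsMaxLinear T H' ∧ H.Reachable b u ∧ IsEnd H u ∧ IsEnd H' u ∧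
      IsEnd H' e ∧ H'.Reachable u e := by
  have hc := hH.not_isEnd_of_adj hbc hn hb
  have hnr : ¬ H.Reachable b c := fun h => hn (adj_of_reachable_of_adj hT hH.le h hbc)
  have hec : e ≠ c := fun h => hc (h ▸ he)
  have heb : e ≠ b := fun h => hnr (h ▸ hce.symm)
  obtain ⟨p, hp⟩ := hce.exists_isPath
  cases p with
  | nil => exact absurd rfl hec
  | @cons _ c1 _ hc1 q =>
    -- `c2` is the neighbor of `c` on the side away from `e`. The path is cut at `c c2`, and the
    -- piece containing `c` and `e` is attached to `b`.
    obtain ⟨c2, hc2, hne⟩ : ∃ c2, H.Adj c c2 ∧ c1 ≠ c2 := by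
      obtain ⟨x, y, hxy, hx, hy⟩ := exists_two_neighbors_of_not_isEnd hc
      by_cases h : c1 = x
      · exact ⟨y, hy, fun h' => hxy (h.symm.trans h')⟩
      · exact ⟨x, hx, h⟩
    have hiff := fun x y => exchange_adj_iff (H := H) (d := c2) (u := x) (v := y) hbc.ne
    obtain ⟨u, hbu, hu, hub⟩ := exists_far_end hT hH.le b
    have hcq : c ∉ q.support := ((Walk.cons_isPath_iff _ _).1 hp).2
    have hreach1 : (ZeroForcing.exchange H b c c2).Reachable c e := by
      refine Reachable.trans (Adj.reachable ((hiff c c1).2 (Or.inl ⟨hc1, ?_⟩)))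
        (q.transfer _ ?_).reachable
      · simp only [ne_eq, Sym2.eq_iff, not_or]
        exact ⟨fun h => hne h.2, fun h => hc2.ne h.1⟩
      · intro f hf
        induction f using Sym2.ind with
        | _ x y =>
          refine (hiff x y).2 (Or.inl ⟨q.adj_of_mem_edges hf, fun h => hcq ?_⟩)
          rcases Sym2.eq_iff.1 h with ⟨rfl, -⟩ | ⟨-, rfl⟩
          · exact q.fst_mem_support_of_mem_edges hf
          · exact q.snd_mem_support_of_mem_edges hf
    have hreach2 : (ZeroForcing.exchange H b c c2).Reachable b u := by
      have hbu' := hbu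
      rw [reachable_iff_reflTransGen] at hbu'
      clear hub hu
      induction hbu' with
      | refl => rfl
      | @tail x y hbx hxy ih =>
        rw [← reachable_iff_reflTransGen] at hbx
        refine (ih hbx).trans (Adj.reachable ((hiff x y).2 (Or.inl ⟨hxy, fun h => hnr ?_⟩)))
        rcases Sym2.eq_iff.1 h with ⟨rfl, -⟩ | ⟨-, rfl⟩
        · exact hbx
        · exact hbx.trans hxy.reachable
    have huc : u ≠ c := fun h => hnr (h ▸ hbu)
    have key : ∀ z, z ≠ b → z ≠ c → IsEnd H z → IsEnd (ZeroForcing.exchange H b c c2) z := by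
      intro z hzb hzc hz x y hx hy
      have e : ∀ w, (ZeroForcing.exchange H b c c2).Adj z w → H.Adj z w := by
        intro w hw
        rcases (hiff z w).1 hw with hw | ⟨hw, -⟩ | ⟨-, hw⟩
        · exact hw.1
        · exact absurd hw.symm hzb
        · exact absurd hw.symm hzc
      exact hz x y (e x hx) (e y hy)
    refine ⟨_, u, hH.exchange hbc hn hb hc2, hbu, hu, ?_, key e heb hec he, hreach2.symm.trans
      (Reachable.trans (Adj.reachable ((hiff b c).2 (Or.inr (Or.inl ⟨rfl, rfl⟩)))) hreach1)⟩
    by_cases hub' : u = b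
    · subst hub'
      intro x y hx hy
      have e : ∀ w, (ZeroForcing.exchange H u c c2).Adj u w → c = w := by
        intro w hw
        rcases (hiff u w).1 hw with hw | ⟨-, hw⟩ | ⟨-, hw⟩
        · exact absurd rfl (hub ⟨w, hw.1⟩)
        · exact hw
        · exact absurd hw.symm huc
      rw [← e x hx, ← e y hy]
    · exact key u hub' huc hu

/-! ### From iso-uniqueness to the three conditions -/

/-- If `T` is iso-unique, then the two ends of a path of a minimum path cover are equivalent. -/
lemma exists_iso_of_isIsoUnique [Fintype V] [DecidableEq V] (hT : T.IsTree)
    (hI : IsIsoUniqueZeroForcing T) (hH : IsMaxLinear T H) {u v : V} (hu : IsEnd H u)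
    (hv : IsEnd H v) (huv : H.Reachable u v) : ∃ φ : T ≃g T, φ u = v := by
  classical
  obtain ⟨S, hS, huS⟩ := exists_isChoice_mem hT hH.le hu
  obtain ⟨φ, hφ⟩ := hI S (insert v (S.erase u)) ((isMinZeroForcingSet_iff hT _).2 ⟨H, hH, hS⟩)
    ((isMinZeroForcingSet_iff hT _).2 ⟨H, hH, hS.replace huS hv huv⟩)
  by_contra hno
  -- Count the elements in the orbit of `u`: automorphisms preserve this number, but replacing `u`
  -- by a `v` outside the orbit would lower it by one.
  let p : V → Prop := fun w => ∃ ψ : T ≃g T, ψ u = w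
  have hp : ∀ w, p (φ w) ↔ p w := by
    intro w
    constructor
    · rintro ⟨ψ, hψ⟩
      exact ⟨ψ.trans φ.symm, by simp [hψ]⟩
    · rintro ⟨ψ, rfl⟩
      exact ⟨ψ.trans φ, rfl⟩
  have h1 : ((S.image φ).filter p).card = (S.filter p).card := by
    rw [Finset.filter_image, Finset.card_image_of_injective _ φ.injective]
    congr 1
    ext w
    simp [hp]
  rw [hφ, Finset.filter_insert, if_neg hno, Finset.filter_erase,
    Finset.card_erase_of_mem (Finset.mem_filter.2 ⟨huS, Iso.refl, rfl⟩)] at h1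
  have : 0 < (S.filter p).card := Finset.card_pos.2 ⟨u, Finset.mem_filter.2 ⟨huS, Iso.refl, rfl⟩⟩
  omega

/-- Let `X` be the union of the paths with no leaf of `T` among their ends. An end `b` in `X` has
two neighbors in `T`. If one of them lay on another path with a leaf end `e`, rerouting would make
`e` and an end of the path of `b` the ends of one path, hence equivalent, and the latter would be a
leaf. So all vertices of `X` have two neighbors in `X`, and `X` is empty. A path with one leaf end
has only leaf ends, again by equivalence. -/
lemma isEnd_of_isIsoUnique [Fintype V] [DecidableEq V] (hT : T.IsTree)
    (hI : IsIsoUniqueZeroForcing T) (hH : IsMaxLinear T H) {v : V} (hv : IsEnd H v) :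
    IsEnd T v := by
  let X : Set V := {v | ∀ e, H.Reachable v e → IsEnd H e → ¬ IsEnd T e}
  have hX : v ∉ X := by
    refine set_eq_empty_of_two_neighbors hT X (fun b hb => ?_) v
    have hadj : ∀ a, H.Adj b a → a ∈ X := fun a ha e hae => hb e (ha.reachable.trans hae)
    by_cases hbe : IsEnd H b
    · have hext : ∀ a, T.Adj b a → a ∈ X := by
        intro a ha
        by_cases hba : H.Adj b a
        · exact hadj a hba
        · intro e hae he heT
          obtain ⟨H', u, hH', hbu, hu, hu', he', hue⟩ := hH.exists_rerouting hT ha hba hbe hae he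
          obtain ⟨φ, rfl⟩ := exists_iso_of_isIsoUnique hT hI hH' hu' he' hue
          exact hb u hbu hu ((isEnd_iso_iff φ u).1 heT)
      obtain ⟨x, y, hxy, hx, hy⟩ := exists_two_neighbors_of_not_isEnd (hb b Reachable.rfl hbe)
      exact ⟨x, hext x hx, y, hext y hy, hxy, hx, hy⟩
    · obtain ⟨x, y, hxy, hx, hy⟩ := exists_two_neighbors_of_not_isEnd hbe
      exact ⟨x, hadj x hx, y, hadj y hy, hxy, hH.le hx, hH.le hy⟩
  simp only [X, Set.mem_ofPred_eq, not_forall, not_not] at hX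
  obtain ⟨e, hve, he, heT⟩ := hX
  obtain ⟨φ, rfl⟩ := exists_iso_of_isIsoUnique hT hI hH he hv hve.symm
  exact (isEnd_iso_iff φ e).2 heT

/-- If all ends are leaves, then an end adjacent to another path forms a path of its own, and the
neighbors of its neighbor on the other path are leaves. -/
lemma IsMaxLinear.isEnd_of_adj_of_not_adj [Finite V] (hH : IsMaxLinear T H)
    (hleaf : ∀ H v, IsMaxLinear T H → IsEnd H v → IsEnd T v) {x y : V} (hxy : T.Adj x y)
    (hn : ¬ H.Adj x y) (hx : IsEnd H x) {d : V} (hd : H.Adj y d) : IsEnd T d := by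
  refine hleaf _ d (hH.exchange hxy hn hx hd) ?_
  have e : ∀ w, (ZeroForcing.exchange H x y d).Adj d w → H.Adj d w ∧ w ≠ y := by
    intro w hw
    rcases (exchange_adj_iff hxy.ne).1 hw with ⟨h1, h2⟩ | ⟨rfl, -⟩ | ⟨-, rfl⟩
    · exact ⟨h1, fun h => h2 (by rw [h, Sym2.eq_swap])⟩
    · exact absurd hd.symm hn
    · exact absurd rfl hd.ne
  intro a b ha hb
  obtain ⟨ha1, ha2⟩ := e a ha
  obtain ⟨hb1, hb2⟩ := e b hb
  rcases hH.deg d a b y ha1 hb1 hd.symm with h | h | h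
  · exact h
  · exact absurd h ha2
  · exact absurd h hb2

lemma partsGraph_adj_of_sequence {A : Finset V} (hA : A ∈ P) {n : ℕ}
    {y : ℕ → V} (hy : IsNonbacktracking T y n) (hmem : ∀ v, v ∈ A ↔ ∃ i ≤ n, y i = v) {i : ℕ}
    (hi : i < n) : (partsGraph T P).Adj (y i) (y (i + 1)) :=
  ⟨hy.adj i hi, A, hA, (hmem _).2 ⟨i, hi.le, rfl⟩, (hmem _).2 ⟨i + 1, hi, rfl⟩⟩

namespace IsPathCover

lemma isInteriorVertex_iff (hP : IsPathCover T P) (hT : T.IsTree) {A : Finset V} (hA : A ∈ P)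
    {v : V} (hv : v ∈ A) : IsInteriorVertex T A v ↔ ¬ IsEnd (partsGraph T P) v := by
  rw [IsInteriorVertex, hP.isEndVertex_iff hT hA]
  tauto

lemma isEnd_last (hP : IsPathCover T P) (hT : T.IsTree) {A : Finset V} (hA : A ∈ P) {n : ℕ}
    {y : ℕ → V} (hy : IsNonbacktracking T y n) (hmem : ∀ v, v ∈ A ↔ ∃ i ≤ n, y i = v) :
    IsEnd (partsGraph T P) (y n) := by
  have := hP.isEnd_first hT hA hy.reverse (by
    intro v
    rw [hmem]
    constructor
    · rintro ⟨j, hj, rfl⟩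
      exact ⟨n - j, by omega, show y (n - (n - j)) = y j from congrArg y (by omega)⟩
    · rintro ⟨j, hj, rfl⟩
      exact ⟨n - j, by omega, rfl⟩)
  simpa using this

/-- A path whose vertex `x` has only leaves as neighbors on the path is isomorphic to `P₃`. -/
lemma nonempty_iso_of_leaves (hP : IsPathCover T P) (hT : T.IsTree) {A : Finset V} (hA : A ∈ P)
    {x : V} (hxA : x ∈ A) (hx : ¬ IsEnd (partsGraph T P) x)
    (hd : ∀ d, (partsGraph T P).Adj x d → IsEnd T d) :
    Nonempty (T.induce (A : Set V) ≃g pathGraph 3) := by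
  obtain ⟨n, y, hy, hmem⟩ := exists_sequence_of_isInducedPath (hP.isInducedPath A hA)
  obtain ⟨i, hi, rfl⟩ := (hmem x).1 hxA
  have hi0 : i ≠ 0 := by rintro rfl; exact hx (hP.isEnd_first hT hA hy hmem)
  have hin : i ≠ n := by rintro rfl; exact hx (hP.isEnd_last hT hA hy hmem)
  obtain ⟨k, rfl⟩ : ∃ k, i = k + 1 := ⟨i - 1, by omega⟩
  have hk : k = 0 := by
    by_contra hk
    obtain ⟨j, rfl⟩ : ∃ j, k = j + 1 := ⟨k - 1, by omega⟩
    have h1 := hd _ (partsGraph_adj_of_sequence hA hy hmem (i := j + 1) (by omega)).symm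
    exact hy.ne j (by omega) (h1 _ _ (hy.adj j (by omega)).symm (hy.adj (j + 1) (by omega)))
  subst hk
  have hn : n = 2 := by
    by_contra hn
    have h1 := hd _ (partsGraph_adj_of_sequence hA hy hmem (i := 1) (by omega))
    exact hy.ne 1 (by omega) (h1 _ _ (hy.adj 1 (by omega)).symm (hy.adj 2 (by omega)))
  subst hn
  obtain ⟨x, hx⟩ := exists_embedding_of_nonbacktracking hT y 2 hy.adj hy.ne
  have hxA : ∀ i, x i ∈ (A : Set V) := fun i => (hmem _).2 ⟨i, by omega, (hx i).symm⟩
  let e : Fin 3 ≃ (A : Set V) := Equiv.ofBijective (fun i => ⟨x i, hxA i⟩) (by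
    constructor
    · intro i j h
      exact x.injective (congrArg Subtype.val h)
    · rintro ⟨v, hv⟩
      obtain ⟨i, hi, rfl⟩ := (hmem v).1 hv
      exact ⟨⟨i, by omega⟩, Subtype.ext (hx _)⟩)
  exact ⟨Iso.symm ⟨e, fun {i j} => x.map_adj_iff⟩⟩

lemma isEnd_of_iso (hP : IsPathCover T P) (hT : T.IsTree) {A : Finset V} (hA : A ∈ P)
    {x : V} (hxA : x ∈ A) (hx : ¬ IsEnd (partsGraph T P) x)
    (hiso : Nonempty (T.induce (A : Set V) ≃g pathGraph 3)) {d : V}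
    (hd : (partsGraph T P).Adj x d) : IsEnd (partsGraph T P) d := by
  obtain ⟨n, y, hy, hmem⟩ := exists_sequence_of_isInducedPath (hP.isInducedPath A hA)
  have hcard : n = 2 := by
    obtain ⟨z, hz⟩ := exists_embedding_of_nonbacktracking hT y n hy.adj hy.ne
    have hA' : A = Finset.univ.map z.toEmbedding := by
      ext v
      rw [hmem, Finset.mem_map]
      constructor
      · rintro ⟨i, hi, rfl⟩
        exact ⟨⟨i, by omega⟩, Finset.mem_univ _, hz _⟩
      · rintro ⟨i, -, rfl⟩
        exact ⟨i, by omega, (hz i).symm⟩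
    have h1 : A.card = n + 1 := by rw [hA']; simp
    obtain ⟨e⟩ := hiso
    have h2 := Nat.card_congr e.toEquiv
    simp at h2
    omega
  subst hcard
  obtain ⟨i, hi, rfl⟩ := (hmem x).1 hxA
  obtain ⟨j, hj, rfl, hij⟩ := hP.adj_sequence hT hA hy hmem hi hd
  have hi0 : i ≠ 0 := by rintro rfl; exact hx (hP.isEnd_first hT hA hy hmem)
  have hin : i ≠ 2 := by rintro rfl; exact hx (hP.isEnd_last hT hA hy hmem)
  have : j = 0 ∨ j = 2 := by omega
  rcases this with rfl | rfl
  · exact hP.isEnd_first hT hA hy hmem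
  · exact hP.isEnd_last hT hA hy hmem

end IsPathCover

/-- If `x` is an end, then `y` is interior by maximality, and exchanging edges shows that its
neighbors on the path are leaves, which leaves a `P₃`. As a leaf of `T` with neighbor `y`, `x` has
no neighbor on its own path. -/
lemma connectorCondition_of_isMinPathCover [Fintype V] (hT : T.IsTree)
    (hleaf : ∀ H v, IsMaxLinear T H → IsEnd H v → IsEnd T v) (hP : IsMinPathCover T P) :
    ConnectorCondition T P := by
  have hH := hP.isMaxLinear hT
  have hnadj : ∀ A ∈ P, ∀ B ∈ P, A ≠ B → ∀ x ∈ A, ∀ y ∈ B, ¬ (partsGraph T P).Adj x y := by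
    intro A hA B hB hAB x hx y hy h
    exact hAB (hP.1.eq_of_mem hA hB ((hP.1.adj_iff hA hx).1 h).2 hy)
  have key : ∀ A ∈ P, ∀ B ∈ P, A ≠ B → ∀ x ∈ A, ∀ y ∈ B, T.Adj x y →
      IsEnd (partsGraph T P) x → InteriorP3ToSingle T B A y x := by
    intro A hA B hB hAB x hx y hy hxy hxe
    have hn := hnadj A hA B hB hAB x hx y hy
    have hye := hH.not_isEnd_of_adj hxy hn hxe
    refine ⟨(hP.1.isInteriorVertex_iff hT hB hy).2 hye, ?_, ?_⟩
    · exact hP.1.nonempty_iso_of_leaves hT hB hy hye fun d hd =>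
        hH.isEnd_of_adj_of_not_adj hleaf hxy hn hxe hd
    · ext w
      rw [Finset.mem_singleton, ← hP.1.reachable_iff hA hx]
      constructor
      · intro hw
        by_contra hne
        obtain ⟨z, hz⟩ := hw.nonempty_neighborSet_left (Ne.symm hne)
        have := hleaf _ x hH hxe z y hz.1 hxy
        exact hn (this ▸ hz)
      · rintro rfl; rfl
  intro A hA B hB hAB x hx y hy hxy
  by_cases hxe : IsEnd (partsGraph T P) x
  · exact Or.inr (Or.inr (key A hA B hB hAB x hx y hy hxy hxe))
  · by_cases hye : IsEnd (partsGraph T P) y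
    · exact Or.inr (Or.inl (key B hB A hA hAB.symm y hy x hx hxy.symm hye))
    · exact Or.inl ⟨(hP.1.isInteriorVertex_iff hT hA hx).2 hxe,
        (hP.1.isInteriorVertex_iff hT hB hy).2 hye⟩

/-- Equivalence of the ends is upgraded to a reversal of the whole path by
`IsNonbacktracking.exists_reflection`. -/
lemma halvesCondition_of_isIsoUnique [Fintype V] [DecidableEq V] (hT : T.IsTree)
    (hI : IsIsoUniqueZeroForcing T) (hP : IsMinPathCover T P) {A : Finset V} (hA : A ∈ P) {ℓ : ℕ}
    (x : pathGraph ℓ ↪g T) (hx : Enumerates x A) : HalvesCondition T x := by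
  cases ℓ with
  | zero => exact ⟨fun i => i.elim0, fun i => i.elim0, fun i => i.elim0⟩
  | succ n =>
    obtain ⟨y, hy, hxy⟩ := exists_sequence_of_embedding x
    have hmem : ∀ v, v ∈ A ↔ ∃ i ≤ n, y i = v := by
      intro v
      rw [← Finset.mem_coe, ← hx, Set.mem_range]
      constructor
      · rintro ⟨i, rfl⟩
        exact ⟨i, by omega, (hxy i).symm⟩
      · rintro ⟨i, hi, rfl⟩
        exact ⟨⟨i, by omega⟩, hxy _⟩
    obtain ⟨φ, hφ⟩ := exists_iso_of_isIsoUnique hT hI (hP.isMaxLinear hT)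
      (hP.1.isEnd_first hT hA hy hmem) (hP.1.isEnd_last hT hA hy hmem)
      ((hP.1.reachable_iff hA ((hmem _).2 ⟨0, by omega, rfl⟩)).2 ((hmem _).2 ⟨n, le_rfl, rfl⟩))
    obtain ⟨c, hc⟩ := exists_center hT
    obtain ⟨ψ, -, hψ, -⟩ := hy.exists_reflection hT hc φ hφ
    refine halvesCondition_of_reversing x ψ fun i j hij => ?_
    rw [hxy, hxy, hψ i (by omega)]
    congr 1
    omega

/-! ### Star centers and rigidity of maximum linear subgraphs -/

/-- `x` is adjacent to at least three leaves. -/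
def IsStarCenter (T : SimpleGraph V) (x : V) : Prop :=
  ∃ a b c, a ≠ b ∧ a ≠ c ∧ b ≠ c ∧ T.Adj x a ∧ T.Adj x b ∧ T.Adj x c ∧
    IsEnd T a ∧ IsEnd T b ∧ IsEnd T c

/-- `v` is neither a star center nor a leaf at a star center. -/
def IsRegular (T : SimpleGraph V) (v : V) : Prop :=
  ¬ IsStarCenter T v ∧ ∀ x, T.Adj v x → IsEnd T v → ¬ IsStarCenter T x

/-- All ends of maximum linear subgraphs are leaves, and an end of a path that is adjacent to a
vertex `y` of another path forces the neighbors of `y` on this path to be leaves. -/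
structure HasLeafEnds (T : SimpleGraph V) : Prop where
  isEnd : ∀ H v, IsMaxLinear T H → IsEnd H v → IsEnd T v
  isEnd_of_adj : ∀ H x y d, IsMaxLinear T H → T.Adj x y → ¬ H.Adj x y → IsEnd H x → H.Adj y d →
    IsEnd T d

namespace HasLeafEnds

lemma not_isEnd_of_isStarCenter (hT : HasLeafEnds T) (hH : IsMaxLinear T H) {x : V}
    (hx : IsStarCenter T x) : ¬ IsEnd H x := by
  obtain ⟨a, b, c, hab, -, -, ha, hb, -⟩ := hx
  exact fun h => hab (hT.isEnd _ _ hH h a b ha hb)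

/-- At most two of the three leaves are joined to `x` in `H`; a remaining one is an end adjacent to
`x`, to which `isEnd_of_adj` applies. -/
lemma isEnd_of_adj_isStarCenter (hT : HasLeafEnds T) (hH : IsMaxLinear T H) {x d : V}
    (hx : IsStarCenter T x) (hd : H.Adj x d) : IsEnd T d := by
  obtain ⟨a, b, c, hab, hac, hbc, ha, hb, hc, ha', hb', hc'⟩ := hx
  have key : ∀ l, T.Adj x l → IsEnd T l → ¬ H.Adj x l → IsEnd T d := by
    intro l hl hl' hn
    exact hT.isEnd_of_adj H l x d hH hl.symm (fun h => hn h.symm)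
      (fun u v hu hv => hl' u v (hH.le hu) (hH.le hv)) hd
  by_cases h1 : H.Adj x a
  · by_cases h2 : H.Adj x b
    · refine key c hc hc' fun h3 => ?_
      rcases hH.deg x a b c h1 h2 h3 with h | h | h <;> contradiction
    · exact key b hb hb' h2
  · exact key a ha ha' h1

lemma isStarCenter_of_isolated [Finite V] (hT : HasLeafEnds T) (hH : IsMaxLinear T H) {v y : V}
    (hv : IsEnd T v) (hiso : ∀ z, ¬ H.Adj v z) (hvy : T.Adj v y) : IsStarCenter T y := by
  have hve : IsEnd H v := fun a b ha hb => absurd ha (hiso a)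
  obtain ⟨d, e, hde, hd, he⟩ :=
    exists_two_neighbors_of_not_isEnd (hH.not_isEnd_of_adj hvy (hiso y) hve)
  refine ⟨v, d, e, ?_, ?_, hde, hvy.symm, hH.le hd, hH.le he, hv,
    hT.isEnd_of_adj H v y d hH hvy (hiso y) hve hd, hT.isEnd_of_adj H v y e hH hvy (hiso y) hve he⟩
  · rintro rfl; exact hiso y hd.symm
  · rintro rfl; exact hiso y he.symm

/-- Maximum linear subgraphs differ only at star centers. -/
lemma adj_of_adj [Finite V] (hT : HasLeafEnds T) (htree : T.IsTree) {H H' : SimpleGraph V}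
    (hH : IsMaxLinear T H) (hH' : IsMaxLinear T H') {u v : V} (hu : ¬ IsStarCenter T u)
    (hv : ¬ IsStarCenter T v) (h : H.Adj u v) : H'.Adj u v := by
  -- Discrepancies continue: `v` is not a leaf, so it has two neighbors in `H'`, and as `H` has
  -- degree at most two and already contains `vw`, one of these edges is missing from `H`.
  have step : ∀ {H H' : SimpleGraph V}, IsMaxLinear T H → IsMaxLinear T H' → ∀ {v w : V},
      ¬ IsStarCenter T w → H.Adj v w → ¬ H'.Adj v w →
      ∃ w', ¬ IsStarCenter T w' ∧ H'.Adj v w' ∧ ¬ H.Adj v w' := by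
    intro H H' hH hH' v w hw hvw hvw'
    have hvl : ¬ IsEnd T v := fun hvl => hw (hT.isStarCenter_of_isolated hH' hvl
      (fun z hz => hvw' (hvl z w (hH'.le hz) (hH.le hvw) ▸ hz)) (hH.le hvw))
    obtain ⟨a, b, hab, ha, hb⟩ :=
      exists_two_neighbors_of_not_isEnd (fun h => hvl (hT.isEnd _ _ hH' h))
    have key : ∃ w', H'.Adj v w' ∧ ¬ H.Adj v w' := by
      by_contra hno
      push Not at hno
      rcases hH.deg v a b w (hno a ha) (hno b hb) hvw with h | h | h
      · exact hab h
      · exact hvw' (h ▸ ha)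
      · exact hvw' (h ▸ hb)
    obtain ⟨w', h1, h2⟩ := key
    exact ⟨w', fun hs => hvl (hT.isEnd_of_adj_isStarCenter hH' hs h1.symm), h1, h2⟩
  by_contra h'
  -- Each vertex of `X` meets one discrepancy of either kind, so it has two neighbors in `X`.
  let X : Set V := {v | ¬ IsStarCenter T v ∧ ∃ w, ¬ IsStarCenter T w ∧
    ((H.Adj v w ∧ ¬ H'.Adj v w) ∨ (H'.Adj v w ∧ ¬ H.Adj v w))}
  refine set_eq_empty_of_two_neighbors htree X ?_ u ⟨hu, v, hv, Or.inl ⟨h, h'⟩⟩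
  rintro a ⟨ha, w, hw, ⟨h1, h2⟩ | ⟨h1, h2⟩⟩
  · obtain ⟨z, hz, h3, h4⟩ := step hH hH' hw h1 h2
    exact ⟨w, ⟨hw, a, ha, Or.inl ⟨h1.symm, fun h => h2 h.symm⟩⟩, z,
      ⟨hz, a, ha, Or.inr ⟨h3.symm, fun h => h4 h.symm⟩⟩, fun e => h4 (e ▸ h1), hH.le h1, hH'.le h3⟩
  · obtain ⟨z, hz, h3, h4⟩ := step hH' hH hw h1 h2
    exact ⟨w, ⟨hw, a, ha, Or.inr ⟨h1.symm, fun h => h2 h.symm⟩⟩, z,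
      ⟨hz, a, ha, Or.inl ⟨h3.symm, fun h => h4 h.symm⟩⟩, fun e => h4 (e ▸ h1), hH'.le h1, hH.le h3⟩

lemma isRegular_of_adj (hT : HasLeafEnds T) (hH : IsMaxLinear T H) {v w : V} (hv : IsRegular T v)
    (h : H.Adj v w) : IsRegular T w := by
  have hw : ¬ IsStarCenter T w := fun hw =>
    hv.2 w (hH.le h) (hT.isEnd_of_adj_isStarCenter hH hw h.symm) hw
  refine ⟨hw, fun x hx hwe hxs => ?_⟩
  rw [hwe x v hx (hH.le h.symm)] at hxs
  exact hv.1 hxs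

lemma isRegular_of_reachable (hT : HasLeafEnds T) (hH : IsMaxLinear T H) {v w : V}
    (hv : IsRegular T v) (h : H.Reachable v w) : IsRegular T w := by
  rw [reachable_iff_reflTransGen] at h
  induction h with
  | refl => exact hv
  | tail _ hbc ih => exact hT.isRegular_of_adj hH ih hbc

/-- A path through a regular vertex consists of regular vertices, so by `adj_of_adj` it is the same
path in every maximum linear subgraph. -/
lemma reachable_of_reachable [Finite V] (hT : HasLeafEnds T) (htree : T.IsTree)
    {H H' : SimpleGraph V} (hH : IsMaxLinear T H) (hH' : IsMaxLinear T H') {v w : V}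
    (hv : IsRegular T v) (h : H.Reachable v w) : H'.Reachable v w := by
  rw [reachable_iff_reflTransGen] at h
  induction h with
  | refl => rfl
  | @tail b c hvb hbc ih =>
    have hb := hT.isRegular_of_reachable hH' hv ih
    have hc := hT.isRegular_of_adj hH hb hbc
    exact ih.trans (hT.adj_of_adj htree hH hH' hb.1 hc.1 hbc).reachable

lemma isEnd_of_isEnd [Finite V] (hT : HasLeafEnds T) (htree : T.IsTree)
    {H H' : SimpleGraph V} (hH : IsMaxLinear T H) (hH' : IsMaxLinear T H') {v : V}
    (hv : IsRegular T v) (h : IsEnd H v) : IsEnd H' v := by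
  have key : ∀ w, H'.Adj v w → H.Adj v w := fun w hw =>
    hT.adj_of_adj htree hH' hH hv.1 (hT.isRegular_of_adj hH' hv hw).1 hw
  exact fun a b ha hb => h a b (key a ha) (key b hb)

end HasLeafEnds

/-! ### Minimum zero forcing sets relative to a fixed maximum linear subgraph -/

/-- `S` consists of one end of each path of `H` without star centers and of all but one of the
leaves at each star center. -/
structure IsAdapted (T H : SimpleGraph V) (S : Finset V) : Prop where
  exists_reachable : ∀ v, IsRegular T v → ∃ s ∈ S, H.Reachable v s
  unique : ∀ s ∈ S, ∀ t ∈ S, IsRegular T s → H.Reachable s t → s = t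
  isEnd : ∀ s ∈ S, IsRegular T s → IsEnd H s
  notMem : ∀ x, IsStarCenter T x → x ∉ S
  missing : ∀ x, IsStarCenter T x → ∃ t, t ∉ S ∧ T.Adj x t ∧ IsEnd T t ∧
    ∀ t', t' ∉ S → T.Adj x t' → IsEnd T t' → t' = t

/-- `S` is a choice for some `H'` that agrees with `H` on the regular vertices. At a star center
`H'` has a path leaf, center, leaf, of which `S` contains one end; the other leaves there are
isolated in `H'` and all belong to `S`. -/
lemma HasLeafEnds.isAdapted [Fintype V] [DecidableEq V] (hT : HasLeafEnds T) (htree : T.IsTree)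
    (hH : IsMaxLinear T H) {S : Finset V} (hS : IsMinZeroForcingSet T S) : IsAdapted T H S := by
  obtain ⟨H', hH', hS⟩ := (isMinZeroForcingSet_iff htree S).1 hS
  refine ⟨?_, ?_, ?_, ?_, ?_⟩
  · intro v hv
    obtain ⟨s, hs, hvs⟩ := hS.exists_reachable v
    exact ⟨s, hs, hT.reachable_of_reachable htree hH' hH hv hvs⟩
  · intro s hs t ht hsr hst
    exact hS.unique s hs t ht (hT.reachable_of_reachable htree hH hH' hsr hst)
  · intro s hs hsr
    exact hT.isEnd_of_isEnd htree hH' hH hsr (hS.isEnd s hs)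
  · intro x hx hxS
    exact hT.not_isEnd_of_isStarCenter hH' hx (hS.isEnd x hxS)
  · intro x hx
    have hcomp : ∀ w, H'.Reachable x w → w = x ∨ H'.Adj x w := by
      intro w hw
      rw [reachable_iff_reflTransGen] at hw
      induction hw with
      | refl => exact Or.inl rfl
      | @tail b c _ hbc ih =>
        rcases ih with rfl | hb
        · exact Or.inr hbc
        · exact Or.inl (hT.isEnd_of_adj_isStarCenter hH' hx hb _ _ (hH'.le hbc) (hH'.le hb.symm))
    have hxe := hT.not_isEnd_of_isStarCenter hH' hx
    obtain ⟨s, hs, hxs⟩ := hS.exists_reachable x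
    have hxs' : H'.Adj x s := by
      rcases hcomp s hxs with rfl | h
      · exact absurd (hS.isEnd _ hs) hxe
      · exact h
    obtain ⟨t, ht, hts⟩ : ∃ t, H'.Adj x t ∧ t ≠ s := by
      obtain ⟨a, b, hab, ha, hb⟩ := exists_two_neighbors_of_not_isEnd hxe
      by_cases h : a = s
      · exact ⟨b, hb, fun h' => hab (h.trans h'.symm)⟩
      · exact ⟨a, ha, h⟩
    refine ⟨t, fun htS => hts (hS.unique t htS s hs (ht.symm.reachable.trans hxs)), hH'.le ht,
      hT.isEnd_of_adj_isStarCenter hH' hx ht, ?_⟩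
    intro t' ht'S hxt' ht'e
    by_cases h : H'.Adj x t'
    · rcases hH'.deg x t' t s h ht hxs' with h1 | h1 | h1
      · exact h1
      · exact absurd (h1 ▸ hs) ht'S
      · exact absurd h1 hts
    · exfalso
      have hiso : ∀ z, ¬ H'.Adj t' z := by
        intro z hz
        rw [ht'e z x (hH'.le hz) hxt'.symm] at hz
        exact h hz.symm
      obtain ⟨s', hs', hr⟩ := hS.exists_reachable t'
      by_cases hne : t' = s'
      · exact ht'S (hne ▸ hs')
      · obtain ⟨z, hz⟩ := hr.nonempty_neighborSet_left hne
        exact hiso z hz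

lemma IsMinZeroForcingSet.image [Fintype V] [DecidableEq V] {S : Finset V}
    (hS : IsMinZeroForcingSet T S) (φ : T ≃g T) : IsMinZeroForcingSet T (S.image φ) := by
  refine ⟨?_, fun S' hS' => (Finset.card_image_of_injective S φ.injective).trans_le (hS.2 S' hS')⟩
  have hu : (Finset.univ : Finset V).image φ = Finset.univ :=
    Finset.image_univ_of_surjective φ.surjective
  rw [IsZeroForcingSet, ← hu]
  refine Relation.ReflTransGen.lift (fun F : Finset V => F.image φ) ?_ _ _ hS.1
  rintro F F' ⟨u, hu, v, hv, huv, hall, rfl⟩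
  refine ⟨φ u, Finset.mem_image_of_mem _ hu, φ v, ?_, φ.map_adj_iff.2 huv, ?_,
    Finset.image_insert _ _ _⟩
  · rwa [φ.injective.mem_finset_image]
  · intro w hw hwv
    obtain ⟨w, rfl⟩ := φ.surjective w
    exact Finset.mem_image_of_mem _ (hall w (φ.map_adj_iff.1 hw) fun h => hwv (h ▸ rfl))

/-- Two leaves with the same neighbor can be exchanged. -/
lemma exists_leaf_swap [DecidableEq V] {x s t : V} (hs : T.Adj x s) (ht : T.Adj x t)
    (hs' : IsEnd T s) (ht' : IsEnd T t) : ∃ φ : T ≃g T, ∀ v, φ v = Equiv.swap s t v := by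
  have hxs := hs.ne
  have hxt := ht.ne
  have hadj : ∀ a b, T.Adj a b → T.Adj (Equiv.swap s t a) (Equiv.swap s t b) := by
    have key : ∀ a b, T.Adj a b → (a = s ∨ a = t) →
        T.Adj (Equiv.swap s t a) (Equiv.swap s t b) := by
      rintro a b h (rfl | rfl)
      · rw [hs' b x h hs.symm, Equiv.swap_apply_left, Equiv.swap_apply_of_ne_of_ne hxs hxt]
        exact ht.symm
      · rw [ht' b x h ht.symm, Equiv.swap_apply_right, Equiv.swap_apply_of_ne_of_ne hxs hxt]
        exact hs.symm
    intro a b h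
    by_cases ha : a = s ∨ a = t
    · exact key a b h ha
    · by_cases hb : b = s ∨ b = t
      · exact (key b a h.symm hb).symm
      · push Not at ha hb
        rwa [Equiv.swap_apply_of_ne_of_ne ha.1 ha.2, Equiv.swap_apply_of_ne_of_ne hb.1 hb.2]
  refine ⟨⟨Equiv.swap s t, fun {a b} => ⟨fun h => ?_, hadj a b⟩⟩, fun v => rfl⟩
  simpa using hadj _ _ h

/-- An automorphism exchanging the ends of one path of a linear subgraph `H` and fixing all other
paths of `H` that come at least as close to a center of the tree. -/
lemma exists_flip [Finite V] (hT : T.IsTree) (hH : IsLinear T H) {c : V}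
    (hc : ∀ φ : T ≃g T, φ c = c ∨ (T.Adj c (φ c) ∧ φ (φ c) = c)) (δ : V → ℕ)
    (hδ : ∀ v, (∃ w, H.Reachable v w ∧ T.dist c w = δ v) ∧
      ∀ w, H.Reachable v w → δ v ≤ T.dist c w)
    (hswap : ∀ u v, IsEnd H u → IsEnd H v → H.Reachable u v → ∃ φ : T ≃g T, φ u = v) {u v : V}
    (hu : IsEnd H u) (hv : IsEnd H v) (huv : H.Reachable u v) (hne : u ≠ v) :
    ∃ ψ : T ≃g T, (∀ w, ψ (ψ w) = w) ∧ ψ u = v ∧ (∀ w, H.Reachable u w → H.Reachable u (ψ w)) ∧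
      ∀ w, ¬ H.Reachable u w → δ w ≤ δ u → ψ w = w := by
  classical
  obtain ⟨n, y, hy, hyadj, hmem, hy0, hyn⟩ := hH.exists_enumeration hT u
  have hends : ∀ w, H.Reachable u w → IsEnd H w → w = y 0 ∨ w = y n := by
    intro w hw hwe
    obtain ⟨i, hi, rfl⟩ := (hmem w).1 hw
    rcases Nat.eq_zero_or_pos i with rfl | hpos
    · exact Or.inl rfl
    rcases eq_or_lt_of_le hi with rfl | hlt
    · exact Or.inr rfl
    · exfalso
      obtain ⟨k, rfl⟩ : ∃ k, i = k + 1 := ⟨i - 1, by omega⟩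
      exact hy.ne k (by omega) (hwe _ _ (hyadj k (by omega)).symm (hyadj (k + 1) (by omega)))
  have hr0 : H.Reachable u (y 0) := (hmem _).2 ⟨0, by omega, rfl⟩
  have hrn : H.Reachable u (y n) := (hmem _).2 ⟨n, le_rfl, rfl⟩
  obtain ⟨φ, hφ⟩ := hswap _ _ hy0 hyn (hr0.symm.trans hrn)
  obtain ⟨ψ, hψψ, hψ, hfix⟩ := hy.exists_reflection hT hc φ hφ
  refine ⟨ψ, hψψ, ?_, ?_, ?_⟩
  · have h0 := hψ 0 (by omega)
    have hn := hψ n le_rfl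
    rw [Nat.sub_zero] at h0
    rw [Nat.sub_self] at hn
    rcases hends u Reachable.rfl hu with h1 | h1 <;> rcases hends v huv hv with h2 | h2
    · exact absurd (h1.trans h2.symm) hne
    · rw [h1, h2, h0]
    · rw [h1, h2, hn]
    · exact absurd (h1.trans h2.symm) hne
  · intro w hw
    obtain ⟨i, hi, rfl⟩ := (hmem w).1 hw
    rw [hψ i hi]
    exact (hmem _).2 ⟨n - i, by omega, rfl⟩
  · intro w hw hδw
    obtain ⟨z, hwz, hz⟩ := (hδ w).1
    rcases hfix with ⟨k, hk, hyk⟩ | ⟨k, hk, hfix⟩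
    -- The center lies on the path, so `δ u = 0`; then `δ w = 0` puts `c` on the path of `w` as
    -- well.
    · exfalso
      have huc : H.Reachable u c := hyk ▸ (hmem _).2 ⟨k, hk, rfl⟩
      have h1 := (hδ u).2 c huc
      rw [SimpleGraph.dist_self] at h1
      have h2 : c = z := (hT.connected.dist_eq_zero_iff).1 (by omega)
      exact hw (huc.trans (h2 ▸ hwz.symm))
    · by_contra hmove
      obtain ⟨j, hj, hadj, hbranch, hdepth⟩ := hfix w hmove
      have h1 := (hδ u).2 (y k) ((hmem _).2 ⟨k, hk, rfl⟩)
      -- The branch containing `w` lies farther from `c` than `y k`, whereas `z`, the vertex nearest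
      -- to `c` on the path of `w`, does not. So the path of `w` leaves the branch and must pass
      -- through `y j`, a vertex of the path of `u`.
      have hzb : ¬ T.dist z (y j) < T.dist z (y k) := by
        intro hzb
        have := dist_across_edge hT hadj hdepth hzb
        omega
      obtain ⟨p⟩ := hwz
      obtain ⟨d, hd, hd1, hd2⟩ := p.exists_boundary_dart
        {w | T.dist w (y j) < T.dist w (y k)} hbranch hzb
      have h2 := (edge_leaving_branch hT hadj (hH.le d.adj) hd1 hd2).1
      have h3 : H.Reachable w d.fst :=
        ⟨p.takeUntil _ (p.dart_fst_mem_support_of_mem_darts hd)⟩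
      rw [h2] at h3
      exact hw (((hmem _).2 ⟨j, hj, rfl⟩ : H.Reachable u (y j)).trans h3.symm)

/-- Two minimum zero forcing sets that agree on the regular vertices are equivalent. -/
lemma HasLeafEnds.exists_iso_of_agree [Fintype V] [DecidableEq V] (hT : HasLeafEnds T)
    (htree : T.IsTree) (hH : IsMaxLinear T H) {S' : Finset V} (hS' : IsMinZeroForcingSet T S')
    (S : Finset V) (hS : IsMinZeroForcingSet T S) (h : ∀ v, IsRegular T v → (v ∈ S ↔ v ∈ S')) :
    ∃ φ : T ≃g T, S.image φ = S' := by
  induction hn : (S \ S').card using Nat.strong_induction_on generalizing S with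
  | _ n ih =>
    have hcard : S.card = S'.card := le_antisymm (hS.2 _ hS'.1) (hS'.2 _ hS.1)
    rcases (S \ S').eq_empty_or_nonempty with he | ⟨s, hs⟩
    · have : S = S' := Finset.eq_of_subset_of_card_le (Finset.sdiff_eq_empty_iff_subset.1 he) hcard.ge
      exact ⟨Iso.refl, by rw [← this]; exact Finset.image_id⟩
    · obtain ⟨hsS, hsS'⟩ := Finset.mem_sdiff.1 hs
      have hA := hT.isAdapted htree hH hS
      have hA' := hT.isAdapted htree hH hS'
      have hsr : ¬ IsRegular T s := fun hr => hsS' ((h s hr).1 hsS)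
      obtain ⟨x, hsx, hse, hx⟩ : ∃ x, T.Adj s x ∧ IsEnd T s ∧ IsStarCenter T x := by
        by_contra hno
        push Not at hno
        exact hsr ⟨fun hs => hA.notMem s hs hsS, hno⟩
      -- `t` is the leaf at `x` that `S` omits. The only leaf at `x` omitted by `S'` is `s`, so `t ∈
      -- S'`, and swapping `s` and `t` shrinks the difference.
      obtain ⟨t, htS, hxt, hte, -⟩ := hA.missing x hx
      obtain ⟨t', -, -, -, huniq⟩ := hA'.missing x hx
      have hts : t ≠ s := fun e => htS (e ▸ hsS)
      have htS' : t ∈ S' := by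
        by_contra htS'
        exact hts ((huniq t htS' hxt hte).trans (huniq s hsS' hsx.symm hse).symm)
      obtain ⟨φ, hφ⟩ := exists_leaf_swap hsx.symm hxt hse hte
      have hmem : ∀ v, v ≠ s → v ≠ t → (v ∈ S.image φ ↔ v ∈ S) := by
        intro v h1 h2
        have hv : φ v = v := by rw [hφ, Equiv.swap_apply_of_ne_of_ne h1 h2]
        conv_lhs => rw [← hv]
        exact φ.injective.mem_finset_image
      have hsim : s ∉ S.image φ := by
        have : φ t = s := by rw [hφ, Equiv.swap_apply_right]
        rw [← this, φ.injective.mem_finset_image]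
        exact htS
      have hlt : (S.image φ \ S').card < n := by
        rw [← hn]
        refine Finset.card_lt_card ⟨?_, fun hsub => hsim (Finset.mem_sdiff.1 (hsub hs)).1⟩
        intro v hv
        obtain ⟨hv1, hv2⟩ := Finset.mem_sdiff.1 hv
        refine Finset.mem_sdiff.2 ⟨(hmem v ?_ ?_).1 hv1, hv2⟩
        · rintro rfl; exact hsim hv1
        · rintro rfl; exact hv2 htS'
      obtain ⟨χ, hχ⟩ := ih _ hlt (S.image φ) (hS.image φ) (by
        intro v hv
        rw [hmem v ?_ ?_, h v hv]
        · rintro rfl; exact hsr hv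
        · rintro rfl; exact hv.2 x hxt.symm hte hx) rfl
      exact ⟨φ.trans χ, by rw [← hχ, Finset.image_image]; rfl⟩

/-- If all ends are leaves and the ends of each path are equivalent, then all minimum zero forcing
sets are equivalent. -/
lemma HasLeafEnds.isIsoUniqueZeroForcing [Fintype V] [DecidableEq V] (hT : HasLeafEnds T)
    (htree : T.IsTree)
    (hswap : ∀ H u v, IsMaxLinear T H → IsEnd H u → IsEnd H v → H.Reachable u v →
      ∃ φ : T ≃g T, φ u = v) : IsIsoUniqueZeroForcing T := by
  obtain ⟨H, hH⟩ := exists_isMaxLinear T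
  obtain ⟨c, hc⟩ := exists_center htree
  -- `δ v` is the distance from the center to the path of `H` through `v`.
  have hδ : ∀ v, ∃ n, (∃ w, H.Reachable v w ∧ T.dist c w = n) ∧
      ∀ w, H.Reachable v w → n ≤ T.dist c w := by
    intro v
    obtain ⟨w, hw, hmin⟩ := Set.exists_min_image {w | H.Reachable v w} (T.dist c) (Set.toFinite _)
      ⟨v, Reachable.rfl⟩
    exact ⟨_, ⟨w, hw, rfl⟩, hmin⟩
  choose δ hδ using hδ
  have hδeq : ∀ u v, H.Reachable u v → δ u = δ v := by
    have key : ∀ u v, H.Reachable u v → δ u ≤ δ v := by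
      intro u v huv
      obtain ⟨w, hw, hw'⟩ := (hδ v).1
      exact hw' ▸ (hδ u).2 w (huv.trans hw)
    exact fun u v huv => le_antisymm (key u v huv) (key v u huv.symm)
  intro S S' hS hS'
  have hA' := hT.isAdapted htree hH hS'
  -- Correct the paths at distance `t`, by induction on the number of wrongly chosen ends. Each flip
  -- fixes all other paths at distance at most `t`, so nothing already correct is disturbed; farther
  -- paths may be disturbed, but they are treated later.
  have level : ∀ t, ∀ S : Finset V, IsMinZeroForcingSet T S →
      (∀ w, IsRegular T w → δ w < t → (w ∈ S ↔ w ∈ S')) →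
      ∃ φ : T ≃g T, ∀ w, IsRegular T w → δ w < t + 1 → (w ∈ S.image φ ↔ w ∈ S') := by
    classical
    intro t S hS hagree
    induction hn : ((S \ S').filter fun w => IsRegular T w ∧ δ w = t).card using
      Nat.strong_induction_on generalizing S with
    | _ n ih =>
      have hA := hT.isAdapted htree hH hS
      rcases ((S \ S').filter fun w => IsRegular T w ∧ δ w = t).eq_empty_or_nonempty with
        he | ⟨u, hu⟩
      · refine ⟨Iso.refl, fun w hw hwt => ?_⟩
        rw [show S.image (Iso.refl : T ≃g T) = S from Finset.image_id]
        rcases Nat.lt_succ_iff_lt_or_eq.1 hwt with hlt | heq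
        · exact hagree w hw hlt
        -- One inclusion suffices, since both sets contain exactly one vertex of each regular path.
        · have hsub : ∀ w, IsRegular T w → δ w = t → w ∈ S → w ∈ S' := by
            intro w hw heq hwS
            by_contra hwS'
            have : w ∈ ((S \ S').filter fun w => IsRegular T w ∧ δ w = t) :=
              Finset.mem_filter.2 ⟨Finset.mem_sdiff.2 ⟨hwS, hwS'⟩, hw, heq⟩
            rw [he] at this
            simp at this
          refine ⟨hsub w hw heq, fun hwS' => ?_⟩
          obtain ⟨s, hs, hws⟩ := hA.exists_reachable w hw
          have hs' := hsub s (hT.isRegular_of_reachable hH hw hws)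
            ((hδeq w s hws).symm.trans heq) hs
          rwa [hA'.unique w hwS' s hs' hw hws]
      · obtain ⟨hu1, hur, hut⟩ := Finset.mem_filter.1 hu
        obtain ⟨huS, huS'⟩ := Finset.mem_sdiff.1 hu1
        obtain ⟨v, hvS', huv⟩ := hA'.exists_reachable u hur
        have hvr := hT.isRegular_of_reachable hH hur huv
        obtain ⟨ψ, hψψ, hψu, hψr, hψf⟩ := exists_flip htree hH.toIsLinear hc δ hδ
          (fun a b => hswap H a b hH) (hA.isEnd u huS hur) (hA'.isEnd v hvS' hvr) huv
          (fun e => huS' (e ▸ hvS'))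
        have hmem : ∀ w, w ∈ S.image ψ ↔ ψ w ∈ S := by
          intro w
          conv_lhs => rw [← hψψ w]
          exact ψ.injective.mem_finset_image
        have hcomp : ∀ w, H.Reachable u w → w ∈ S.image ψ → w ∈ S' := by
          intro w huw hw
          rw [hmem] at hw
          have h1 := hA.unique u huS _ hw hur (hψr w huw)
          rw [← hψψ w, ← h1, hψu]
          exact hvS'
        have hother : ∀ w, ¬ H.Reachable u w → δ w ≤ t → (w ∈ S.image ψ ↔ w ∈ S) := by
          intro w huw hw
          rw [hmem, hψf w huw (by omega)]
        have hlt : (((S.image ψ) \ S').filter fun w => IsRegular T w ∧ δ w = t).card < n := by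
          rw [← hn]
          refine Finset.card_lt_card ⟨?_, fun hsub => ?_⟩
          · intro w hw
            obtain ⟨hw1, hwr, hwt⟩ := Finset.mem_filter.1 hw
            obtain ⟨hw2, hw3⟩ := Finset.mem_sdiff.1 hw1
            have huw : ¬ H.Reachable u w := fun huw => hw3 (hcomp w huw hw2)
            exact Finset.mem_filter.2
              ⟨Finset.mem_sdiff.2 ⟨(hother w huw hwt.le).1 hw2, hw3⟩, hwr, hwt⟩
          · exact huS' (hcomp u Reachable.rfl
              (Finset.mem_sdiff.1 (Finset.mem_filter.1 (hsub hu)).1).1)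
        obtain ⟨χ, hχ⟩ := ih _ hlt (S.image ψ) (hS.image ψ) (by
          intro w hw hwt
          rw [hother w (fun huw => by have := hδeq u w huw; omega) hwt.le]
          exact hagree w hw hwt) rfl
        refine ⟨ψ.trans χ, ?_⟩
        rw [Finset.image_image] at hχ
        exact hχ
  have all : ∀ t, ∃ φ : T ≃g T, ∀ w, IsRegular T w → δ w < t → (w ∈ S.image φ ↔ w ∈ S') := by
    intro t
    induction t with
    | zero => exact ⟨Iso.refl, fun w _ h => absurd h (Nat.not_lt_zero _)⟩
    | succ t ih =>
      obtain ⟨φ, hφ⟩ := ih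
      obtain ⟨χ, hχ⟩ := level t (S.image φ) (hS.image φ) hφ
      refine ⟨φ.trans χ, ?_⟩
      rw [Finset.image_image] at hχ
      exact hχ
  obtain ⟨N, hN⟩ := (Set.finite_range δ).bddAbove
  obtain ⟨φ, hφ⟩ := all (N + 1)
  obtain ⟨χ, hχ⟩ := hT.exists_iso_of_agree htree hH hS' (S.image φ) (hS.image φ)
    fun v hv => hφ v hv (Nat.lt_succ_of_le (hN ⟨v, rfl⟩))
  exact ⟨φ.trans χ, by rw [← hχ, Finset.image_image]; rfl⟩

/-! ### From the three conditions to iso-uniqueness -/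

/-- When `x` is an end, (ii) leaves only the case where `y` is the middle of a `P₃`; its neighbors
there are ends, hence leaves by (i). -/
lemma hasLeafEnds_of_conditions [Fintype V] (hT : T.IsTree)
    (hleaf : ∀ P, IsMinPathCover T P → ∀ A ∈ P, ∀ v, IsEndVertex T A v → IsEnd T v)
    (hconn : ∀ P, IsMinPathCover T P → ConnectorCondition T P) : HasLeafEnds T where
  isEnd H v hH hv := by
    obtain ⟨P, hP, rfl⟩ := hH.exists_isMinPathCover hT
    obtain ⟨A, hA, hvA⟩ := hP.1.cover v
    exact hleaf P hP A hA v ((hP.1.isEndVertex_iff hT hA v).2 ⟨hvA, hv⟩)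
  isEnd_of_adj H x y d hH hxy hn hx hd := by
    obtain ⟨P, hP, rfl⟩ := hH.exists_isMinPathCover hT
    obtain ⟨A, hA, hxA⟩ := hP.1.cover x
    obtain ⟨B, hB, hyB⟩ := hP.1.cover y
    have hAB : A ≠ B := by
      rintro rfl
      exact hn ⟨hxy, A, hA, hxA, hyB⟩
    have hxi : ¬ IsInteriorVertex T A x := fun h => (hP.1.isInteriorVertex_iff hT hA hxA).1 h hx
    rcases hconn P hP A hA B hB hAB x hxA y hyB hxy with h | h | h
    · exact absurd h.1 hxi
    · exact absurd h.1 hxi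
    · have h1 := hP.1.isEnd_of_iso hT hB hyB ((hP.1.isInteriorVertex_iff hT hB hyB).1 h.1) h.2.1 hd
      have hdB : d ∈ B := ((hP.1.adj_iff hB hyB).1 hd).2
      exact hleaf P hP B hB d ((hP.1.isEndVertex_iff hT hB d).2 ⟨hdB, h1⟩)

lemma exists_iso_of_halvesCondition [Fintype V] (hT : T.IsTree)
    (hhalves : ∀ P, IsMinPathCover T P → ∀ A ∈ P, ∀ (ℓ : ℕ) (x : pathGraph ℓ ↪g T),
      Enumerates x A → HalvesCondition T x)
    (H : SimpleGraph V) (u v : V) (hH : IsMaxLinear T H) (hu : IsEnd H u) (hv : IsEnd H v)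
    (huv : H.Reachable u v) : ∃ φ : T ≃g T, φ u = v := by
  obtain ⟨P, hP, rfl⟩ := hH.exists_isMinPathCover hT
  obtain ⟨A, hA, huA⟩ := hP.1.cover u
  have hvA := (hP.1.reachable_iff hA huA).1 huv
  obtain ⟨n, x, hx, rfl⟩ := (hP.1.isEndVertex_iff hT hA u).2 ⟨huA, hu⟩
  obtain ⟨φ, h1, h2⟩ := (hhalves P hP A hA (n + 1) x hx).swap 0 (Fin.last n) rfl rfl
  have hv' : v = x 0 ∨ v = x (Fin.last n) := by
    rw [← Finset.mem_coe, ← hx] at hvA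
    obtain ⟨i, rfl⟩ := hvA
    by_contra hno
    push Not at hno
    have hi0 : i.val ≠ 0 := fun h => hno.1 (congrArg x (Fin.ext h))
    have hin : i.val ≠ n := fun h => hno.2 (congrArg x (Fin.ext h))
    have hmem : ∀ j, x j ∈ A := fun j => by rw [← Finset.mem_coe, ← hx]; exact ⟨j, rfl⟩
    have hadj : ∀ j : Fin (n + 1), i.val + 1 = j.val ∨ j.val + 1 = i.val →
        (partsGraph T P).Adj (x i) (x j) := fun j hj =>
      ⟨x.map_adj_iff.2 (pathGraph_adj.2 hj), A, hA, hmem i, hmem j⟩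
    have := hv _ _ (hadj ⟨i.val - 1, by omega⟩ (by simp; omega))
      (hadj ⟨i.val + 1, by omega⟩ (by simp))
    have := congrArg Fin.val (x.injective this)
    simp at this
  rcases hv' with rfl | rfl
  · exact ⟨Iso.refl, rfl⟩
  · exact ⟨φ, h1⟩

end ZeroForcing

theorem mainTheorem1 {V : Type*} [Fintype V] [DecidableEq V] [Nontrivial V]
    (T : SimpleGraph V) [DecidableRel T.Adj] (hT : T.IsTree) :
    ZeroForcing.IsIsoUniqueZeroForcing T ↔
      ∀ P : Finset (Finset V), ZeroForcing.IsMinPathCover T P →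
        ZeroForcing.EndVerticesAreLeaves T P ∧
        ZeroForcing.ConnectorCondition T P ∧
        ∀ A ∈ P, ∀ (ℓ : ℕ) (x : SimpleGraph.pathGraph ℓ ↪g T), ZeroForcing.Enumerates x A →
          ZeroForcing.HalvesCondition T x := by
  constructor
  · intro hI P hP
    have hleaf := fun H v hH hv => ZeroForcing.isEnd_of_isIsoUnique (H := H) (v := v) hT hI hH hv
    refine ⟨fun A hA v hv => ?_, ZeroForcing.connectorCondition_of_isMinPathCover hT hleaf hP,
      fun A hA ℓ x hx => ZeroForcing.halvesCondition_of_isIsoUnique hT hI hP hA x hx⟩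
    exact (ZeroForcing.isEnd_iff_degree_eq_one hT v).1
      (hleaf _ v (hP.isMaxLinear hT) ((hP.1.isEndVertex_iff hT hA v).1 hv).2)
  · intro h
    refine (ZeroForcing.hasLeafEnds_of_conditions hT (fun P hP A hA v hv => ?_)
      fun P hP => (h P hP).2.1).isIsoUniqueZeroForcing hT
      (ZeroForcing.exists_iso_of_halvesCondition hT fun P hP => (h P hP).2.2)
    exact (ZeroForcing.isEnd_iff_degree_eq_one hT v).2 ((h P hP).1 A hA v hv)
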